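/- **Theorem (GBM eigenvalues and eigenfunctions).** Let $\mu\in\mathbb R$, $k\ge 0$, $\sigma>0$, and put $$\xi=\frac{\mu+k}{\sigma}-\frac{\sigma}{2},\qquad \mathfrak m(x)=\frac{2}{x\sigma^2}\exp\Big(2\xi\,\frac1\sigma\log x\Big)\quad(x>0).$$ Let $\mathscr A^1=\tfrac12\sigma^2x^2\,\partial_{xx}^2+(\mu+k)x\,\partial_x-k$ be regarded as an operator in $L^2((0,\infty),\mathfrak m(x)dx)$ (complex valued functions) with domain $\{f\in L^2(\mathfrak m):\mathscr A^1f\in L^2(\mathfrak m)\}$, the derivatives being taken in the weak sense on $(0,\infty)$. For $\omega\in\mathbb R$ let $$\psi_\omega(x)=\sqrt{\frac{\sigma}{4\pi}}\,\exp\Big((i\omega-\xi)\frac1\sigma\log x\Big),\qquad \lambda_\omega=\tfrac12(\omega^2+\xi^2)+k .$$ 1. The spectrum of $\mathscr A^1$ is purely continuous, $\sigma(\mathscr A^1)=\sigma_c(\mathscr A^1)$ (every spectral point $\lambda$ is not an eigenvalue, and $\mathscr A^1-\lambda$ has dense range), and $\sigma(\mathscr A^1)=\{-\lambda_\omega:\omega\in\mathbb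 R\}$. 2. The $\psi_\omega$ are the improper eigenfunctions of $-\mathscr A^1$, with improper eigenvalues $\lambda_\omega$. Here an improper eigenfunction with improper eigenvalue $\lambda\in\mathbb C$ is a function $f\in C^2((0,\infty))$ with $-\mathscr A^1f=\lambda f$ pointwise on $(0,\infty)$ and $f\notin L^2(\mathfrak m)$, where $\lambda$ lies in the essential spectrum of $-\mathscr A^1$ (the spectrum without its isolated points that are eigenvalues of finite multiplicity), such that $|f(x)|^2\,\mathfrak m(x)\,\sigma x$ (that is, $|f|^2$ times the density of $\mathfrak m(x)dx$ with respect to $z=\frac1\sigma\log x$) stays bounded as $x\searrow0$ and as $x\nearrow\infty$. Precisely: for every $\omega\in\mathbb R$, $\psi_\omega$ is an improper eigenfunction with improper eigenvalue $\lambda_\omega$; conversely, if $f$ is an improper eigenfunction with improper eigenvalue $\lambda$, then $\lambda=\lambda_\omega$ for some $\omega\in\mathbb R$, and $f$ is a linear combination of $\psi_\omega$ and $\psi_{-\omega}$ on $(0,\infty)$. 3. The $\psi_\omega$ are delta-normalized, $(\psi_\omega,\psi_\nu)=\delta(\omega-\nu)$, in the sense of distributions in $\nu$: for every $\omega\in\mathbb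 R$ and every Schwartz function $\varphi$ on $\mathbb R$, $$\lim_{a\searrow0,\;b\to\infty}\int_{-\infty}^{\infty}\varphi(\nu)\Big(\int_a^b\overline{\psi_\omega(x)}\,\psi_\nu(x)\,\mathfrak m(x)\,dx\Big)d\nu=\varphi(\omega),$$ where all the integrals over $(a,b)$ with $0<a<b<\infty$ and over $\nu$ converge absolutely. -/

import Mathlib

open Set Filter Topology MeasureTheory
open scoped SchwartzMap ComplexConjugate

noncomputable section

/-! ### Spectral theory of an unbounded operator `A : H →ₗ.[ℂ] H` -/

namespace UnboundedOp

variable {H : Type*} [NormedAddCommGroup H] [InnerProductSpace ℂ H]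

/-- `l` is in the resolvent set iff `A - l` is a bijection from `Dom A` onto `H` whose inverse
`R` is a bounded operator on `H`. -/
def resolventSet (A : H →ₗ.[ℂ] H) : Set ℂ :=
  {l | ∃ R : H →L[ℂ] H,
    (∀ g : H, ∃ hg : R g ∈ A.domain, A ⟨R g, hg⟩ - l • R g = g) ∧
    (∀ f : A.domain, R (A f - l • (f : H)) = f)}

def spectrum (A : H →ₗ.[ℂ] H) : Set ℂ := (resolventSet A)ᶜ

def eigenspace (A : H →ₗ.[ℂ] H) (l : ℂ) : Submodule ℂ H where
  carrier := {f | ∃ hf : f ∈ A.domain, A ⟨f, hf⟩ = l • f}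
  zero_mem' := ⟨A.domain.zero_mem, by
    rw [smul_zero]; exact A.map_zero⟩
  add_mem' := by
    rintro f g ⟨hf, hf'⟩ ⟨hg, hg'⟩
    refine ⟨A.domain.add_mem hf hg, ?_⟩
    rw [smul_add, ← hf', ← hg', ← A.map_add]
    rfl
  smul_mem' := by
    rintro c f ⟨hf, hf'⟩
    refine ⟨A.domain.smul_mem c hf, ?_⟩
    rw [smul_comm, ← hf', ← A.map_smul]
    rfl

/-- Isolated points of the spectrum that are eigenvalues of finite multiplicity. -/
def discreteSpectrum (A : H →ₗ.[ℂ] H) : Set ℂ :=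
  {l | l ∈ spectrum A ∧ (∃ U ∈ 𝓝 l, U ∩ spectrum A = {l}) ∧
    eigenspace A l ≠ ⊥ ∧ FiniteDimensional ℂ (eigenspace A l)}

def essentialSpectrum (A : H →ₗ.[ℂ] H) : Set ℂ := spectrum A \ discreteSpectrum A

/-- Spectral points that are not eigenvalues and for which `A - l` has dense range. -/
def continuousSpectrum (A : H →ₗ.[ℂ] H) : Set ℂ :=
  {l | l ∈ spectrum A ∧ eigenspace A l = ⊥ ∧
    Dense (range fun f : A.domain => A f - l • (f : H))}

end UnboundedOp

/-- `v` is the weak derivative of `u` on the half-line `(0, ∞)`. -/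
def HasWeakDerivOnHalfLine (u v : ℝ → ℂ) : Prop :=
  LocallyIntegrableOn u (Ioi 0) ∧ LocallyIntegrableOn v (Ioi 0) ∧
    ∀ φ : ℝ → ℝ, ContDiff ℝ ((⊤ : ℕ∞) : WithTop ℕ∞) φ → HasCompactSupport φ → tsupport φ ⊆ Ioi 0 →
      ∫ x, deriv φ x • u x = -∫ x, φ x • v x

lemma integrable_testFunction_smul {u : ℝ → ℂ} (hu : LocallyIntegrableOn u (Ioi 0))
    {φ : ℝ → ℝ} (hφ : Continuous φ) (hc : HasCompactSupport φ) (hs : tsupport φ ⊆ Ioi 0) :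
    Integrable fun x => φ x • u x := by
  have h1 : IntegrableOn u (tsupport φ) := hu.integrableOn_compact_subset hs hc
  have h2 : IntegrableOn (fun x => φ x • u x) (tsupport φ) :=
    h1.continuousOn_smul hφ.continuousOn hc
  refine (integrableOn_iff_integrable_of_support_subset ?_).1 h2
  intro x hx
  refine subset_tsupport φ ?_
  intro h0
  exact hx (by simp [h0])

namespace HasWeakDerivOnHalfLine

lemma zero : HasWeakDerivOnHalfLine 0 0 := by
  refine ⟨?_, ?_, ?_⟩
  · exact (locallyIntegrable_zero).locallyIntegrableOn _
  · exact (locallyIntegrable_zero).locallyIntegrableOn _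
  · intro φ _ _ _
    simp

lemma add {u v u' v' : ℝ → ℂ} (h : HasWeakDerivOnHalfLine u v)
    (h' : HasWeakDerivOnHalfLine u' v') : HasWeakDerivOnHalfLine (u + u') (v + v') := by
  refine ⟨h.1.add h'.1, h.2.1.add h'.2.1, ?_⟩
  intro φ hφ hc hs
  have hd : Continuous (deriv φ) := hφ.continuous_deriv (by simp)
  have hds : tsupport (deriv φ) ⊆ Ioi 0 := (tsupport_deriv_subset).trans hs
  simp only [Pi.add_apply, smul_add]
  rw [integral_add (integrable_testFunction_smul h.1 hd hc.deriv hds)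
      (integrable_testFunction_smul h'.1 hd hc.deriv hds),
    integral_add (integrable_testFunction_smul h.2.1 hφ.continuous hc hs)
      (integrable_testFunction_smul h'.2.1 hφ.continuous hc hs),
    h.2.2 φ hφ hc hs, h'.2.2 φ hφ hc hs, neg_add]

lemma smul {u v : ℝ → ℂ} (c : ℂ) (h : HasWeakDerivOnHalfLine u v) :
    HasWeakDerivOnHalfLine (c • u) (c • v) := by
  refine ⟨h.1.smul c, h.2.1.smul c, ?_⟩
  intro φ hφ hc hs
  simp only [Pi.smul_apply]
  simp_rw [smul_comm _ c, integral_smul]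
  rw [h.2.2 φ hφ hc hs, smul_neg]

lemma ae_eq_zero {u v : ℝ → ℂ} (h : HasWeakDerivOnHalfLine u v)
    (hu : ∀ᵐ x : ℝ, x ∈ Ioi (0 : ℝ) → u x = 0) : ∀ᵐ x : ℝ, x ∈ Ioi (0 : ℝ) → v x = 0 := by
  refine isOpen_Ioi.ae_eq_zero_of_integral_contDiff_smul_eq_zero h.2.1 ?_
  intro φ hφ hc hs
  have h0 : ∫ x, deriv φ x • u x = 0 := by
    refine integral_eq_zero_of_ae ?_
    filter_upwards [hu] with x hx
    by_cases hx0 : x ∈ Ioi (0 : ℝ)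
    · simp [hx hx0]
    · have : deriv φ x = 0 := by
        by_contra hne
        exact hx0 (hs (tsupport_deriv_subset (subset_tsupport _ hne)))
      simp [this]
  rw [h.2.2 φ hφ hc hs] at h0
  exact neg_eq_zero.1 h0

end HasWeakDerivOnHalfLine

/-! ### Geometric Brownian motion killed at rate `k` -/

namespace GBM

def xi (μ k σ : ℝ) : ℝ := (μ + k) / σ - σ / 2

def speedDensity (μ k σ x : ℝ) : ℝ :=
  2 / (x * σ ^ 2) * Real.exp (2 * xi μ k σ * (1 / σ) * Real.log x)

/-- The measure `m(x) dx` on `(0, ∞)` (as a measure on `ℝ` carried by `(0, ∞)`). -/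
def speedMeasure (μ k σ : ℝ) : Measure ℝ :=
  (volume.restrict (Ioi 0)).withDensity fun x => ENNReal.ofReal (speedDensity μ k σ x)

/-- The Hilbert space `L²((0, ∞), m)`. -/
abbrev HilbertSpace (μ k σ : ℝ) : Type := Lp ℂ 2 (speedMeasure μ k σ)

/-- The value `½ σ² x² u₂ + (μ + k) x u₁ - k u₀` of the differential expression at `x`, where
`u₀, u₁, u₂` stand for the function and its first two derivatives. -/
def diffExpr (μ k σ x : ℝ) (u₀ u₁ u₂ : ℂ) : ℂ :=
  (1 / 2 : ℂ) * (σ : ℂ) ^ 2 * (x : ℂ) ^ 2 * u₂ + ((μ : ℂ) + k) * x * u₁ - k * u₀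

/-- The graph of the operator: pairs `(f, h)` in `L²(m) × L²(m)` such that `f` has weak
derivatives of first and second order on `(0, ∞)`, and the differential expression applied to
`f` is `h`. -/
def generatorGraph (μ k σ : ℝ) : Submodule ℂ (HilbertSpace μ k σ × HilbertSpace μ k σ) where
  carrier := {p | ∃ u u₁ u₂ : ℝ → ℂ,
    HasWeakDerivOnHalfLine u u₁ ∧ HasWeakDerivOnHalfLine u₁ u₂ ∧
    (p.1 : ℝ → ℂ) =ᵐ[speedMeasure μ k σ] u ∧
    (p.2 : ℝ → ℂ) =ᵐ[speedMeasure μ k σ] fun x => diffExpr μ k σ x (u x) (u₁ x) (u₂ x)}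
  zero_mem' := by
    refine ⟨0, 0, 0, .zero, .zero, Lp.coeFn_zero _ _ _, ?_⟩
    filter_upwards [Lp.coeFn_zero ℂ 2 (speedMeasure μ k σ)] with x hx
    simpa [diffExpr] using hx
  add_mem' := by
    rintro p q ⟨u, u₁, u₂, h1, h2, h3, h4⟩ ⟨v, v₁, v₂, g1, g2, g3, g4⟩
    refine ⟨u + v, u₁ + v₁, u₂ + v₂, h1.add g1, h2.add g2, ?_, ?_⟩
    · exact (Lp.coeFn_add p.1 q.1).trans (h3.add g3)
    · filter_upwards [Lp.coeFn_add p.2 q.2, h4, g4] with x hx h g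
      rw [Prod.snd_add, hx, Pi.add_apply, h, g]
      simp only [diffExpr, Pi.add_apply]
      ring
  smul_mem' := by
    rintro c p ⟨u, u₁, u₂, h1, h2, h3, h4⟩
    refine ⟨c • u, c • u₁, c • u₂, h1.smul c, h2.smul c, ?_, ?_⟩
    · exact (Lp.coeFn_smul c p.1).trans (h3.const_smul c)
    · filter_upwards [Lp.coeFn_smul c p.2, h4] with x hx h
      rw [Prod.smul_snd, hx, Pi.smul_apply, h]
      simp only [diffExpr, Pi.smul_apply, smul_eq_mul]
      ring

/-- The operator `½ σ² x² ∂ₓₓ + (μ + k) x ∂ₓ - k` in `L²((0, ∞), m)` with its maximal domain: all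
`f ∈ L²(m)` such that the differential expression, with weak derivatives, maps `f` into `L²(m)`. -/
def generator (μ k σ : ℝ) : HilbertSpace μ k σ →ₗ.[ℂ] HilbertSpace μ k σ :=
  (generatorGraph μ k σ).toLinearPMap

lemma speedDensity_pos (μ k : ℝ) {σ x : ℝ} (hσ : 0 < σ) (hx : 0 < x) :
    0 < speedDensity μ k σ x := by
  unfold speedDensity
  positivity

lemma measurable_speedDensity (μ k σ : ℝ) : Measurable (speedDensity μ k σ) := by
  unfold speedDensity
  fun_prop

lemma ae_speedMeasure_iff (μ k : ℝ) {σ : ℝ} (hσ : 0 < σ) (p : ℝ → Prop) :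
    (∀ᵐ x ∂speedMeasure μ k σ, p x) ↔ ∀ᵐ x : ℝ, x ∈ Ioi (0 : ℝ) → p x := by
  unfold speedMeasure
  rw [ae_withDensity_iff (measurable_speedDensity μ k σ).ennreal_ofReal,
    ae_restrict_iff' measurableSet_Ioi]
  refine eventually_congr (Eventually.of_forall fun x => ?_)
  refine forall_congr' fun hx => ?_
  have := speedDensity_pos μ k hσ hx
  simp [this]

/-- The graph above is the graph of a map, so that `generator` is the operator it describes. -/
lemma generator_graph (μ k : ℝ) {σ : ℝ} (hσ : 0 < σ) :
    (generator μ k σ).graph = generatorGraph μ k σ := by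
  refine Submodule.toLinearPMap_graph_eq _ ?_
  rintro ⟨f, h⟩ ⟨u, u₁, u₂, h1, h2, h3, h4⟩ hf
  simp only at hf h3 h4 ⊢
  subst hf
  have hu : ∀ᵐ x : ℝ, x ∈ Ioi (0 : ℝ) → u x = 0 := by
    rw [← ae_speedMeasure_iff μ k hσ]
    filter_upwards [h3, Lp.coeFn_zero ℂ 2 (speedMeasure μ k σ)] with x hx hx'
    rw [← hx, hx', Pi.zero_apply]
  have hu1 := h1.ae_eq_zero hu
  have hu2 := h2.ae_eq_zero hu1
  rw [← ae_speedMeasure_iff μ k hσ] at hu hu1 hu2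
  rw [Lp.eq_zero_iff_ae_eq_zero]
  filter_upwards [h4, hu, hu1, hu2] with x hx a b c
  rw [hx, a, b, c]
  simp [diffExpr]

/-- `f` is an improper eigenfunction of minus the generator with improper eigenvalue `l`: `l` is in
the essential spectrum, `f` is a classical solution of the eigenvalue equation on `(0, ∞)` that is
not in `L²(m)`, and `|f|²` times the density of `m(x) dx` with respect to the Lamperti coordinate
`z = ∫ dx / (σ x) = (log x) / σ` stays bounded at both ends of `(0, ∞)`. -/
def IsImproperEigenfunction (μ k σ : ℝ) (l : ℂ) (f : ℝ → ℂ) : Prop :=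
  l ∈ UnboundedOp.essentialSpectrum (-generator μ k σ) ∧
  ContDiffOn ℝ 2 f (Ioi 0) ∧
  (∀ x : ℝ, 0 < x → -diffExpr μ k σ x (f x) (deriv f x) (deriv (deriv f) x) = l * f x) ∧
  ¬ MemLp f 2 (speedMeasure μ k σ) ∧
  IsBoundedUnder (· ≤ ·) (𝓝[>] 0) (fun x => ‖f x‖ ^ 2 * (speedDensity μ k σ x * (σ * x))) ∧
  IsBoundedUnder (· ≤ ·) atTop (fun x => ‖f x‖ ^ 2 * (speedDensity μ k σ x * (σ * x)))

def psi (μ k σ ω x : ℝ) : ℂ :=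
  (Real.sqrt (σ / (4 * Real.pi)) : ℂ) *
    Complex.exp ((Complex.I * ω - xi μ k σ) * (1 / σ) * Real.log x)

def lam (μ k σ ω : ℝ) : ℝ := (ω ^ 2 + xi μ k σ ^ 2) / 2 + k

end GBM

/-- The inner product `∫ conj (f x) * g x * m x` over the bounded interval `(a, b)`. -/
def truncatedInner (m : ℝ → ℝ) (a b : ℝ) (f g : ℝ → ℂ) : ℂ :=
  ∫ x in Ioo a b, conj (f x) * g x * (m x : ℂ)

/-- `(ψ_ω, ψ_ν) = δ(ω - ν)` in `L²((0, ∞), m)`: for every `ω`, the inner products of `ψ_ω` and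
`ψ_ν` over `(a, b)`, as distributions in `ν`, tend to the Dirac distribution at `ω` as `a → 0+` and
`b → ∞`. -/
def IsDeltaNormalized (m : ℝ → ℝ) (ψ : ℝ → ℝ → ℂ) : Prop :=
  (∀ (ω ν a b : ℝ), 0 < a → a < b →
    IntegrableOn (fun x => conj (ψ ω x) * ψ ν x * (m x : ℂ)) (Ioo a b)) ∧
  ∀ (φ : 𝓢(ℝ, ℂ)) (ω : ℝ),
    (∀ a b : ℝ, 0 < a → a < b →
      Integrable fun ν : ℝ => φ ν * truncatedInner m a b (ψ ω) (ψ ν)) ∧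
    Tendsto (fun p : ℝ × ℝ => ∫ ν : ℝ, φ ν * truncatedInner m p.1 p.2 (ψ ω) (ψ ν))
      (𝓝[>] 0 ×ˢ atTop) (𝓝 (φ ω))

end

/-!
In the Lamperti coordinate `z = (log x) / σ` geometric Brownian motion is a Brownian motion with
drift `ξ`. The speed measure has density `a(z)²` with respect to `dz`, where
`a(z) = √(2/σ) exp (ξ z)`, so `f ↦ a(z) f(exp (σ z))` is a unitary map from `L²(m)` onto `L²(ℝ)`
(`GBM.lamperti`). It removes the drift: the generator becomes `½ ∂² - (ξ²/2 + k)`, and the Fourier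
transform turns this into multiplication by `-λ_ω`, `ω` being the frequency.

*Maximal domains correspond.* The generator is defined by weak derivatives on `(0, ∞)`, so it has to
be shown that its graph is mapped exactly onto the graph of the multiplication operator
(`GBM.generator_isDiagonalizedBy`). If `f` is in the domain, the equation for its transform holds
weakly against test functions; by truncation it holds against Schwartz functions, and hence on the
Fourier side (`L2Fourier.fourier_eq_of_weak_equation`). Conversely, if `ĝ` and `η² ĝ` are in `L²`,
then so is `η ĝ`, the inverse transforms of `2πi η ĝ` and `-(2π η)² ĝ` are the weak derivatives of
`g`, and the substitution carries them back to the half-line (`GBM.mem_graph_of_fourier_eq`).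

*The spectrum.* For multiplication by a continuous function `s` with closed range and level sets of
measure zero, the spectrum is the range of `s` and is purely continuous: off the range `1 / (s - l)`
is bounded, at a point `l` of the range functions concentrated where `s` is close to `l` are
approximate eigenfunctions, and `s ≠ l` almost everywhere gives both injectivity and dense range
(`UnboundedOp.IsDiagonalizedBy`). As there are no eigenvalues, all of the spectrum is essential.

*Improper eigenfunctions.* The transform of a solution `f` of `-A f = λ_ω f` is a solution `g` of
`g'' = -ω² g`, and the growth condition on `f` says that `g` is bounded; so `g` is a combination of
`exp (± i ω z)`. The transform of `ψ_ω` is `exp (i ω z) / √(2π)`, which is bounded but not in `L²`.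

*Delta normalization.* In the coordinate `z` the pairing of `ψ_ω` and `ψ_ν` over `(a, b)` is
`(2π)⁻¹ ∫ exp (i (ν - ω) z) dz` over an interval that exhausts the line. By Fubini, its pairing with
`φ` is a truncated Fourier inversion integral for `φ` at `ω`.
-/

/-! ### Multiplication operators in `L²(ℝ)` -/

lemma MeasureTheory.MemLp.bounded_continuous_mul {m g : ℝ → ℂ} (hm : Continuous m) {C : ℝ}
    (hC : ∀ x, ‖m x‖ ≤ C) (hg : MemLp g 2 volume) : MemLp (fun x => m x * g x) 2 volume :=
  hg.of_le_mul (c := C) (hm.aestronglyMeasurable.mul hg.1) (ae_of_all _ fun x => by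
    rw [norm_mul]
    exact mul_le_mul_of_nonneg_right (hC x) (norm_nonneg _))

/-- Multiplication by a bounded continuous function, as a bounded operator on `L²(ℝ)`. -/
noncomputable def mulLp (m : ℝ → ℂ) (hm : Continuous m) (C : ℝ) (hC : ∀ x, ‖m x‖ ≤ C) :
    Lp ℂ 2 (volume : Measure ℝ) →L[ℂ] Lp ℂ 2 (volume : Measure ℝ) :=
  LinearMap.mkContinuous
    { toFun := fun g => ((Lp.memLp g).bounded_continuous_mul hm hC).toLp _
      map_add' := fun g h => by
        rw [← MemLp.toLp_add]
        refine MemLp.toLp_congr _ _ ?_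
        filter_upwards [Lp.coeFn_add g h] with x hx
        rw [hx, Pi.add_apply, Pi.add_apply, mul_add]
      map_smul' := fun c g => by
        rw [RingHom.id_apply, ← MemLp.toLp_const_smul]
        refine MemLp.toLp_congr _ _ ?_
        filter_upwards [Lp.coeFn_smul c g] with x hx
        simp only [hx, Pi.smul_apply, smul_eq_mul]
        ring } C fun g => by
    refine Lp.norm_le_mul_norm_of_ae_le_mul ?_
    filter_upwards [((Lp.memLp g).bounded_continuous_mul hm hC).coeFn_toLp] with x hx
    simp only [LinearMap.coe_mk, AddHom.coe_mk]
    rw [hx, norm_mul]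
    exact mul_le_mul_of_nonneg_right (hC x) (norm_nonneg _)

lemma coeFn_mulLp {m : ℝ → ℂ} (hm : Continuous m) {C : ℝ} (hC : ∀ x, ‖m x‖ ≤ C)
    (g : Lp ℂ 2 (volume : Measure ℝ)) : mulLp m hm C hC g =ᵐ[volume] fun x => m x * g x :=
  ((Lp.memLp g).bounded_continuous_mul hm hC).coeFn_toLp

namespace UnboundedOp

variable {H : Type*} [NormedAddCommGroup H] [InnerProductSpace ℂ H]

/-- The unitary map `V` carries the operator `A` to the maximal operator of multiplication by the
function `s` in `L²(ℝ)`. -/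
def IsDiagonalizedBy (A : H →ₗ.[ℂ] H) (V : H ≃ₗᵢ[ℂ] Lp ℂ 2 (volume : Measure ℝ))
    (s : ℝ → ℂ) : Prop :=
  ∀ f h : H, (f, h) ∈ A.graph ↔ (fun x => s x * V f x) =ᵐ[volume] V h

namespace IsDiagonalizedBy

variable {A : H →ₗ.[ℂ] H} {V : H ≃ₗᵢ[ℂ] Lp ℂ 2 (volume : Measure ℝ)} {s : ℝ → ℂ}

lemma neg (hA : IsDiagonalizedBy A V s) : IsDiagonalizedBy (-A) V (-s) := by
  intro f h
  have h1 : (f, h) ∈ (-A).graph ↔ (f, -h) ∈ A.graph := by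
    rw [LinearPMap.neg_graph, Submodule.mem_map]
    constructor
    · rintro ⟨⟨a, b⟩, hab, he⟩
      simp only [LinearMap.prodMap_apply, LinearMap.id_coe, id_eq, LinearMap.neg_apply,
        Prod.mk.injEq] at he
      rw [← he.1, ← he.2, neg_neg]
      exact hab
    · intro hf
      exact ⟨_, hf, by simp⟩
  rw [h1, hA f (-h), map_neg]
  constructor
  · intro he
    filter_upwards [he, Lp.coeFn_neg (V h)] with x hx hx'
    rw [Pi.neg_apply, neg_mul, hx, hx', Pi.neg_apply, neg_neg]
  · intro he
    filter_upwards [he, Lp.coeFn_neg (V h)] with x hx hx'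
    rw [hx', Pi.neg_apply, ← hx, Pi.neg_apply, neg_mul, neg_neg]

lemma mul_apply (hA : IsDiagonalizedBy A V s) (f : A.domain) :
    (fun x => s x * V (f : H) x) =ᵐ[volume] V (A f) :=
  (hA f (A f)).1 (A.mem_graph f)

lemma exists_domain (hA : IsDiagonalizedBy A V s) {f h : H}
    (hfh : (fun x => s x * V f x) =ᵐ[volume] V h) :
    ∃ hf : f ∈ A.domain, A ⟨f, hf⟩ = h := by
  obtain ⟨y, hy, hy'⟩ := A.mem_graph_iff.1 ((hA f h).2 hfh)
  simp only at hy hy'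
  subst hy
  exact ⟨y.2, hy'⟩

lemma mem_resolventSet (hA : IsDiagonalizedBy A V s) (hs : Continuous s)
    (hc : IsClosed (range s)) {l : ℂ} (hl : l ∉ range s) : l ∈ resolventSet A := by
  obtain ⟨ε, hε, hball⟩ := Metric.isOpen_iff.1 hc.isOpen_compl l hl
  have hd : ∀ x, ε ≤ ‖s x - l‖ := by
    intro x
    by_contra! hlt
    exact hball (by rwa [Metric.mem_ball, dist_eq_norm]) (mem_range_self x)
  have hne : ∀ x, s x - l ≠ 0 := fun x h0 => by
    have := hd x
    rw [h0, norm_zero] at this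
    linarith
  have hm : Continuous fun x => (s x - l)⁻¹ := (hs.sub continuous_const).inv₀ hne
  have hC : ∀ x, ‖(s x - l)⁻¹‖ ≤ ε⁻¹ := fun x => by
    rw [norm_inv]
    exact inv_anti₀ hε (hd x)
  let M := mulLp _ hm _ hC
  refine ⟨(V.symm.toContinuousLinearEquiv : Lp ℂ 2 (volume : Measure ℝ) →L[ℂ] H) ∘L M ∘L
    (V.toContinuousLinearEquiv : H →L[ℂ] Lp ℂ 2 (volume : Measure ℝ)), ?_, ?_⟩
  · intro g
    have h1 : (fun x => s x * V (V.symm (M (V g))) x) =ᵐ[volume]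
        V (g + l • V.symm (M (V g))) := by
      rw [map_add, map_smul, LinearIsometryEquiv.apply_symm_apply]
      filter_upwards [coeFn_mulLp hm hC (V g), Lp.coeFn_add (V g) (l • M (V g)),
        Lp.coeFn_smul l (M (V g))] with x h1 h2 h3
      rw [h2, Pi.add_apply, h3, Pi.smul_apply, h1, smul_eq_mul]
      field_simp [hne x]
      ring
    obtain ⟨hf, hf'⟩ := hA.exists_domain h1
    refine ⟨hf, ?_⟩
    simp only [ContinuousLinearMap.comp_apply]
    exact (sub_eq_iff_eq_add.2 hf')
  · intro f
    simp only [ContinuousLinearMap.comp_apply]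
    refine V.injective ?_
    refine (V.apply_symm_apply _).trans ?_
    refine Lp.ext ?_
    refine (coeFn_mulLp hm hC _).trans ?_
    change (fun x => (s x - l)⁻¹ * (V (A f - l • (f : H))) x) =ᵐ[volume] _
    rw [map_sub, map_smul]
    filter_upwards [hA.mul_apply f, Lp.coeFn_sub (V (A f)) (l • V (f : H)),
      Lp.coeFn_smul l (V (f : H))] with x h1 h2 h3
    rw [h2, Pi.sub_apply, h3, Pi.smul_apply, ← h1, smul_eq_mul]
    field_simp [hne x]

/-- An indicator function concentrated where `s` is close to `l` is an approximate eigenfunction, so that the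
inverse of `A - l` cannot be bounded. -/
lemma notMem_resolventSet (hA : IsDiagonalizedBy A V s) (hs : Continuous s) {l : ℂ}
    (hl : l ∈ range s) : l ∉ resolventSet A := by
  rintro ⟨R, -, hR⟩
  obtain ⟨x₀, rfl⟩ := hl
  set N := ‖R‖ + 1 with hN
  have hNpos : 0 < N := by positivity
  set E : Set ℝ := {x | ‖s x - s x₀‖ < 1 / N} ∩ Ioo (x₀ - 1) (x₀ + 1) with hE
  have hEo : IsOpen E :=
    (isOpen_lt (hs.sub continuous_const).norm continuous_const).inter isOpen_Ioo
  have hEx : x₀ ∈ E := ⟨by simp [hNpos], by simp⟩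
  have hEfin : volume E ≠ ⊤ :=
    ((measure_mono inter_subset_right).trans_lt measure_Ioo_lt_top).ne
  have hEpos : volume E ≠ 0 := (hEo.measure_pos volume ⟨x₀, hEx⟩).ne'
  set F : Lp ℂ 2 (volume : Measure ℝ) := indicatorConstLp 2 hEo.measurableSet hEfin 1 with hF
  have hFc : F =ᵐ[volume] E.indicator fun _ => (1 : ℂ) := indicatorConstLp_coeFn
  have hGm : MemLp (fun x => (s x - s x₀) * F x) 2 volume := by
    refine (Lp.memLp F).of_le_mul (c := 1 / N)
      ((hs.sub continuous_const).aestronglyMeasurable.mul (Lp.memLp F).1) ?_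
    filter_upwards [hFc] with x hx
    rw [hx, norm_mul]
    by_cases hxE : x ∈ E
    · exact mul_le_mul_of_nonneg_right hxE.1.le (norm_nonneg _)
    · simp [hxE]
  have hGn : ‖hGm.toLp‖ ≤ 1 / N * ‖F‖ := by
    refine Lp.norm_le_mul_norm_of_ae_le_mul ?_
    filter_upwards [hFc, hGm.coeFn_toLp] with x hx hx'
    rw [hx', norm_mul, hx]
    by_cases hxE : x ∈ E
    · exact mul_le_mul_of_nonneg_right hxE.1.le (norm_nonneg _)
    · simp [hxE]
  have h1 : (fun x => s x * V (V.symm F) x) =ᵐ[volume]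
      V (V.symm (hGm.toLp + s x₀ • F)) := by
    rw [LinearIsometryEquiv.apply_symm_apply, LinearIsometryEquiv.apply_symm_apply]
    filter_upwards [hGm.coeFn_toLp, Lp.coeFn_add hGm.toLp (s x₀ • F),
      Lp.coeFn_smul (s x₀) F] with x h1 h2 h3
    rw [h2, Pi.add_apply, h3, Pi.smul_apply, h1, smul_eq_mul]
    ring
  obtain ⟨hf, hf'⟩ := hA.exists_domain h1
  have h2 := hR ⟨_, hf⟩
  rw [hf', map_add, map_smul, add_sub_cancel_right] at h2
  have h3 : ‖F‖ ≤ ‖R‖ * (1 / N * ‖F‖) := by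
    calc ‖F‖ = ‖V.symm F‖ := (V.symm.norm_map F).symm
      _ = ‖R (V.symm hGm.toLp)‖ := by rw [h2]
      _ ≤ ‖R‖ * ‖V.symm hGm.toLp‖ := R.le_opNorm _
      _ = ‖R‖ * ‖hGm.toLp‖ := by rw [V.symm.norm_map]
      _ ≤ _ := by gcongr
  have hFpos : 0 < ‖F‖ := by
    rw [norm_pos_iff]
    intro h0
    have := norm_indicatorConstLp (p := 2) (hs := hEo.measurableSet) (hμs := hEfin) (c := (1 : ℂ))
      (by norm_num) (by norm_num)
    rw [← hF, h0, norm_zero, norm_one, one_mul] at this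
    have hr : 0 < (volume E).toReal := ENNReal.toReal_pos hEpos hEfin
    have := Real.rpow_pos_of_pos hr (1 / (2 : ENNReal).toReal)
    simp only [Measure.real] at *
    linarith
  have h4 : ‖R‖ * (1 / N * ‖F‖) = ‖F‖ * (‖R‖ / N) := by ring
  have h5 : ‖R‖ / N < 1 := by
    rw [div_lt_one hNpos]
    linarith
  nlinarith

lemma spectrum_eq (hA : IsDiagonalizedBy A V s) (hs : Continuous s) (hc : IsClosed (range s)) :
    spectrum A = range s := by
  ext l
  constructor
  · intro h
    by_contra hl
    exact h (hA.mem_resolventSet hs hc hl)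
  · intro hl
    exact hA.notMem_resolventSet hs hl

lemma eigenspace_eq_bot (hA : IsDiagonalizedBy A V s) {l : ℂ}
    (hl : ∀ᵐ x : ℝ, s x ≠ l) : eigenspace A l = ⊥ := by
  rw [eq_bot_iff]
  rintro f ⟨hf, hf'⟩
  have h1 := hA.mul_apply ⟨f, hf⟩
  rw [hf', map_smul] at h1
  rw [Submodule.mem_bot, ← V.map_eq_zero_iff, Lp.eq_zero_iff_ae_eq_zero]
  filter_upwards [h1, hl, Lp.coeFn_smul l (V f)] with x h1 h2 h3
  rw [h3, Pi.smul_apply, smul_eq_mul] at h1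
  exact (mul_eq_mul_right_iff.1 h1).resolve_left h2

/-- If `w` is orthogonal to the range of `A - l`, test with the `f` for which `V f` is
`conj (s - l) (1 + |s - l|²)⁻¹ V w`. -/
lemma dense_range [CompleteSpace H] (hA : IsDiagonalizedBy A V s) (hs : Continuous s) {l : ℂ}
    (hl : ∀ᵐ x : ℝ, s x ≠ l) : Dense (range fun f : A.domain => A f - l • (f : H)) := by
  let K : Submodule ℂ H := LinearMap.range (A.toFun - l • A.domain.subtype)
  have hK : (K : Set H) = range fun f : A.domain => A f - l • (f : H) := by
    ext y
    simp [K]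
  rw [← hK, Submodule.dense_iff_topologicalClosure_eq_top, Submodule.topologicalClosure_eq_top_iff,
    eq_bot_iff]
  intro w hw
  rw [Submodule.mem_orthogonal'] at hw
  have hden : ∀ x, (1 + ‖s x - l‖ ^ 2 : ℝ) ≠ 0 := fun x => by positivity
  have hm : Continuous fun x => conj (s x - l) * (((1 + ‖s x - l‖ ^ 2)⁻¹ : ℝ) : ℂ) := by
    refine (Complex.continuous_conj.comp (hs.sub continuous_const)).mul
      (Complex.continuous_ofReal.comp (Continuous.inv₀ ?_ hden))
    exact continuous_const.add ((hs.sub continuous_const).norm.pow 2)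
  have hC : ∀ x, ‖conj (s x - l) * (((1 + ‖s x - l‖ ^ 2)⁻¹ : ℝ) : ℂ)‖ ≤ 1 := fun x => by
    rw [norm_mul, RCLike.norm_conj, Complex.norm_real, Real.norm_of_nonneg (by positivity),
      ← div_eq_mul_inv, div_le_one (by positivity)]
    nlinarith [sq_nonneg (‖s x - l‖ - 1)]
  have hp : Continuous fun x => ((‖s x - l‖ ^ 2 * (1 + ‖s x - l‖ ^ 2)⁻¹ : ℝ) : ℂ) := by
    refine Complex.continuous_ofReal.comp (Continuous.mul ?_ (Continuous.inv₀ ?_ hden))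
    · exact (hs.sub continuous_const).norm.pow 2
    · exact continuous_const.add ((hs.sub continuous_const).norm.pow 2)
  have hpC : ∀ x, ‖((‖s x - l‖ ^ 2 * (1 + ‖s x - l‖ ^ 2)⁻¹ : ℝ) : ℂ)‖ ≤ 1 := fun x => by
    rw [Complex.norm_real, Real.norm_of_nonneg (by positivity), ← div_eq_mul_inv,
      div_le_one (by positivity)]
    linarith
  set F := mulLp _ hm _ hC (V w)
  set G := mulLp _ hp _ hpC (V w)
  have h1 : (fun x => s x * V (V.symm F) x) =ᵐ[volume] V (V.symm (G + l • F)) := by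
    rw [LinearIsometryEquiv.apply_symm_apply, LinearIsometryEquiv.apply_symm_apply]
    filter_upwards [coeFn_mulLp hm hC (V w), coeFn_mulLp hp hpC (V w), Lp.coeFn_add G (l • F),
      Lp.coeFn_smul l F] with x h1 h2 h3 h4
    rw [h3, Pi.add_apply, h4, Pi.smul_apply, h1, h2, smul_eq_mul]
    have : ((‖s x - l‖ ^ 2 : ℝ) : ℂ) = (s x - l) * conj (s x - l) := by
      rw [Complex.mul_conj, Complex.normSq_eq_norm_sq]
    rw [Complex.ofReal_mul, this]
    ring
  obtain ⟨hf, hf'⟩ := hA.exists_domain h1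
  have h2 : inner ℂ w (V.symm G) = 0 := by
    refine hw _ ⟨⟨_, hf⟩, ?_⟩
    have : A ⟨V.symm F, hf⟩ - l • V.symm F = V.symm G := by
      rw [hf', map_add, map_smul, add_sub_cancel_right]
    exact this
  have h3 : inner ℂ (V w) G = 0 := by
    rw [← V.inner_map_map, V.apply_symm_apply] at h2
    exact h2
  rw [L2.inner_def] at h3
  have h4 : (fun x => inner ℂ (V w x) (G x)) =ᵐ[volume]
      fun x => ((‖s x - l‖ ^ 2 * (1 + ‖s x - l‖ ^ 2)⁻¹ * ‖V w x‖ ^ 2 : ℝ) : ℂ) := by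
    filter_upwards [coeFn_mulLp hp hpC (V w)] with x hx
    rw [hx, RCLike.inner_apply, mul_assoc, Complex.mul_conj, Complex.normSq_eq_norm_sq,
      ← Complex.ofReal_mul]
  have hint : Integrable fun x => ‖s x - l‖ ^ 2 * (1 + ‖s x - l‖ ^ 2)⁻¹ * ‖V w x‖ ^ 2 := by
    have := ((L2.integrable_inner (𝕜 := ℂ) (V w) G).congr h4).re
    simpa only [RCLike.re_to_complex, Complex.ofReal_re] using this
  rw [integral_congr_ae h4, integral_complex_ofReal, Complex.ofReal_eq_zero,
    integral_eq_zero_iff_of_nonneg (fun x => by positivity) hint] at h3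
  rw [Submodule.mem_bot, ← V.map_eq_zero_iff, Lp.eq_zero_iff_ae_eq_zero]
  filter_upwards [h3, hl] with x h1 h2
  have h5 : ‖s x - l‖ ^ 2 * (1 + ‖s x - l‖ ^ 2)⁻¹ ≠ 0 :=
    mul_ne_zero (pow_ne_zero _ (norm_ne_zero_iff.2 (sub_ne_zero.2 h2))) (inv_ne_zero (hden x))
  have h6 := (mul_eq_zero.1 h1).resolve_left h5
  simpa using h6

lemma continuousSpectrum_eq [CompleteSpace H] (hA : IsDiagonalizedBy A V s) (hs : Continuous s)
    (hl : ∀ l : ℂ, ∀ᵐ x : ℝ, s x ≠ l) : continuousSpectrum A = spectrum A := by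
  ext l
  exact ⟨fun h => h.1, fun h => ⟨h, hA.eigenspace_eq_bot (hl l), hA.dense_range hs (hl l)⟩⟩

lemma essentialSpectrum_eq (hA : IsDiagonalizedBy A V s)
    (hl : ∀ l : ℂ, ∀ᵐ x : ℝ, s x ≠ l) : essentialSpectrum A = spectrum A := by
  ext l
  exact ⟨fun h => h.1, fun h => ⟨h, fun h' => h'.2.2.1 (hA.eigenspace_eq_bot (hl l))⟩⟩

end IsDiagonalizedBy

end UnboundedOp

/-! ### Weak derivatives and the Fourier transform in `L²(ℝ)` -/

namespace L2Fourier

open FourierTransform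

lemma integral_smul_fourier (f : Lp ℂ 2 (volume : Measure ℝ)) (φ : 𝓢(ℝ, ℂ)) :
    ∫ x, φ x • (𝓕 f : Lp ℂ 2 (volume : Measure ℝ)) x = ∫ x, (𝓕 φ) x • f x := by
  rw [← Lp.toTemperedDistribution_apply, ← Lp.fourier_toTemperedDistribution_eq,
    TemperedDistribution.fourier_apply, Lp.toTemperedDistribution_apply]

/-- The Schwartz function `x ↦ -2πi x φ(x)`, whose Fourier transform is the derivative of that of
`φ`. -/
noncomputable def mulX (φ : 𝓢(ℝ, ℂ)) : 𝓢(ℝ, ℂ) :=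
  -(2 * Real.pi * Complex.I) • SchwartzMap.smulLeftCLM ℂ (fun x : ℝ => inner ℝ x (1 : ℝ)) φ

lemma mulX_apply (φ : 𝓢(ℝ, ℂ)) (x : ℝ) : mulX φ x = -(2 * Real.pi * Complex.I * x) * φ x := by
  have : (fun x : ℝ => inner ℝ x (1 : ℝ)).HasTemperateGrowth := by fun_prop
  simp only [mulX, smul_apply, SchwartzMap.smulLeftCLM_apply_apply this]
  simp
  ring

lemma fourier_mulX (φ : 𝓢(ℝ, ℂ)) (x : ℝ) : 𝓕 (mulX φ) x = deriv (𝓕 φ : 𝓢(ℝ, ℂ)) x := by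
  rw [mulX, ← SchwartzMap.lineDerivOp_fourier_eq, SchwartzMap.lineDerivOp_apply_eq_fderiv,
    fderiv_apply_one_eq_deriv]

lemma deriv_schwartz_eq_fourier (φ : 𝓢(ℝ, ℂ)) (x : ℝ) : deriv φ x = 𝓕 (mulX (𝓕⁻ φ)) x := by
  rw [fourier_mulX, fourier_fourierInv_eq]

/-- If the Fourier transform of `G₁` is `2πi x` times that of `G`, then `G₁` is the weak derivative
of `G`. -/
lemma integral_deriv_smul {G G₁ : Lp ℂ 2 (volume : Measure ℝ)}
    (h : ∀ᵐ x : ℝ, 2 * Real.pi * Complex.I * x * (𝓕 G : Lp ℂ 2 (volume : Measure ℝ)) x =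
      (𝓕 G₁ : Lp ℂ 2 (volume : Measure ℝ)) x) (φ : 𝓢(ℝ, ℂ)) :
    ∫ x, deriv φ x • G x = -∫ x, φ x • G₁ x := by
  simp_rw [deriv_schwartz_eq_fourier φ]
  rw [← integral_smul_fourier]
  have e : ∫ x, φ x • G₁ x = ∫ x, (𝓕 (𝓕⁻ φ) : 𝓢(ℝ, ℂ)) x • G₁ x := by
    rw [fourier_fourierInv_eq]
  rw [e, ← integral_smul_fourier, ← integral_neg]
  refine integral_congr_ae ?_
  filter_upwards [h] with x hx
  rw [mulX_apply, ← hx, smul_eq_mul, smul_eq_mul]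
  ring

lemma integral_deriv_smul_real {G G₁ : Lp ℂ 2 (volume : Measure ℝ)}
    (h : ∀ᵐ x : ℝ, 2 * Real.pi * Complex.I * x * (𝓕 G : Lp ℂ 2 (volume : Measure ℝ)) x =
      (𝓕 G₁ : Lp ℂ 2 (volume : Measure ℝ)) x) {φ : ℝ → ℝ}
    (hφ : ContDiff ℝ ((⊤ : ℕ∞) : WithTop ℕ∞) φ) (hc : HasCompactSupport φ) :
    ∫ x, deriv φ x • G x = -∫ x, φ x • G₁ x := by
  have h1 : HasCompactSupport fun x => (φ x : ℂ) := hc.comp_left (g := Complex.ofReal) (by simp)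
  have h2 : ContDiff ℝ ((⊤ : ℕ∞) : WithTop ℕ∞) fun x => (φ x : ℂ) :=
    Complex.ofRealCLM.contDiff.comp hφ
  have h3 := integral_deriv_smul h (h1.toSchwartzMap h2)
  have h4 : ∀ x, deriv (h1.toSchwartzMap h2) x = ((deriv φ x : ℝ) : ℂ) := fun x =>
    ((hφ.differentiable (by simp)).differentiableAt.hasDerivAt.ofReal_comp).deriv
  simp_rw [h4] at h3
  simp only [Complex.real_smul, smul_eq_mul] at h3 ⊢
  exact h3

/-- A weak equation against test functions extends, by truncation, to all smooth functions for which
the integrals converge. -/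
lemma weak_equation_of_integrable {g h : ℝ → ℂ} {c : ℝ}
    (H : ∀ φ : ℝ → ℝ, ContDiff ℝ ((⊤ : ℕ∞) : WithTop ℕ∞) φ → HasCompactSupport φ →
      ∫ x, (1 / 2 * deriv (deriv φ) x - c * φ x) • g x = ∫ x, φ x • h x)
    {Φ : ℝ → ℝ} (hΦ : ContDiff ℝ ((⊤ : ℕ∞) : WithTop ℕ∞) Φ)
    (h0 : Integrable fun x => Φ x • g x) (h1 : Integrable fun x => deriv Φ x • g x)
    (h2 : Integrable fun x => deriv (deriv Φ) x • g x) (h3 : Integrable fun x => Φ x • h x)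
    (hg : AEStronglyMeasurable g) (hh : AEStronglyMeasurable h) :
    ∫ x, (1 / 2 * deriv (deriv Φ) x - c * Φ x) • g x = ∫ x, Φ x • h x := by
  let b : ContDiffBump (0 : ℝ) := ⟨1, 2, one_pos, one_lt_two⟩
  have hb : ContDiff ℝ ((⊤ : ℕ∞) : WithTop ℕ∞) b := b.contDiff
  have hb' : ContDiff ℝ ((⊤ : ℕ∞) : WithTop ℕ∞) (deriv b) :=
    (contDiff_infty_iff_deriv.1 hb).2
  have hb'' : ContDiff ℝ ((⊤ : ℕ∞) : WithTop ℕ∞) (deriv (deriv b)) :=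
    (contDiff_infty_iff_deriv.1 hb').2
  have hΦ' : ContDiff ℝ ((⊤ : ℕ∞) : WithTop ℕ∞) (deriv Φ) := (contDiff_infty_iff_deriv.1 hΦ).2
  have hΦ'' : ContDiff ℝ ((⊤ : ℕ∞) : WithTop ℕ∞) (deriv (deriv Φ)) :=
    (contDiff_infty_iff_deriv.1 hΦ').2
  obtain ⟨M₀, hM₀⟩ := hb.continuous.bounded_above_of_compact_support b.hasCompactSupport
  obtain ⟨M₁, hM₁⟩ := hb'.continuous.bounded_above_of_compact_support b.hasCompactSupport.deriv
  obtain ⟨M₂, hM₂⟩ :=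
    hb''.continuous.bounded_above_of_compact_support b.hasCompactSupport.deriv.deriv
  have hM₀0 : 0 ≤ M₀ := (norm_nonneg _).trans (hM₀ 0)
  have hM₁0 : 0 ≤ M₁ := (norm_nonneg _).trans (hM₁ 0)
  have hM₂0 : 0 ≤ M₂ := (norm_nonneg _).trans (hM₂ 0)
  -- the second derivative of `x ↦ b (ε x) Φ x`
  let D : ℝ → ℝ → ℝ := fun ε x => ε ^ 2 * deriv (deriv b) (ε * x) * Φ x +
    2 * ε * deriv b (ε * x) * deriv Φ x + b (ε * x) * deriv (deriv Φ) x
  have hd : ∀ (f : ℝ → ℝ), ContDiff ℝ ((⊤ : ℕ∞) : WithTop ℕ∞) f → ∀ x, HasDerivAt f (deriv f x) x :=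
    fun f hf x => (hf.differentiable (by simp)).differentiableAt.hasDerivAt
  have hcomp : ∀ (f : ℝ → ℝ), ContDiff ℝ ((⊤ : ℕ∞) : WithTop ℕ∞) f → ∀ ε x,
      HasDerivAt (fun x => f (ε * x)) (ε * deriv f (ε * x)) x := fun f hf ε x => by
    have := (hd f hf (ε * x)).comp x ((hasDerivAt_id x).const_mul ε)
    simpa [mul_comm, Function.comp_def] using this
  have hD1 : ∀ ε, deriv (fun x => b (ε * x) * Φ x) =
      fun x => ε * deriv b (ε * x) * Φ x + b (ε * x) * deriv Φ x := fun ε => by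
    funext x
    exact ((hcomp b hb ε x).mul (hd Φ hΦ x)).deriv
  have hD2 : ∀ ε, deriv (deriv (fun x => b (ε * x) * Φ x)) = D ε := fun ε => by
    funext x
    rw [hD1]
    have := ((((hcomp _ hb' ε x).const_mul ε).mul (hd Φ hΦ x)).add
      ((hcomp b hb ε x).mul (hd _ hΦ' x))).deriv
    refine this.trans ?_
    simp only [D]
    ring
  have key : ∀ ε : ℝ, 0 < ε →
      ∫ x, (1 / 2 * D ε x - c * (b (ε * x) * Φ x)) • g x = ∫ x, (b (ε * x) * Φ x) • h x := by
    intro ε hε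
    rw [← hD2]
    refine H _ ((hb.comp (contDiff_const.mul contDiff_id)).mul hΦ) ?_
    have : HasCompactSupport fun x => b (ε * x) :=
      b.hasCompactSupport.comp_homeomorph (Homeomorph.mulLeft₀ ε hε.ne')
    exact this.mul_right
  have hcont : ∀ x, Continuous fun ε => D ε x := fun x => by
    have e1 : Continuous fun ε : ℝ => deriv (deriv b) (ε * x) :=
      hb''.continuous.comp (continuous_id.mul continuous_const)
    have e2 : Continuous fun ε : ℝ => deriv b (ε * x) :=
      hb'.continuous.comp (continuous_id.mul continuous_const)
    have e3 : Continuous fun ε : ℝ => b (ε * x) :=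
      hb.continuous.comp (continuous_id.mul continuous_const)
    simp only [D]
    fun_prop
  have hcb : ∀ x, Continuous fun ε : ℝ => b (ε * x) := fun x =>
    hb.continuous.comp (continuous_id.mul continuous_const)
  have hcx : ∀ ε, Continuous fun x => D ε x := fun ε => by
    have e1 : Continuous fun x : ℝ => deriv (deriv b) (ε * x) :=
      hb''.continuous.comp (continuous_const.mul continuous_id)
    have e2 : Continuous fun x : ℝ => deriv b (ε * x) :=
      hb'.continuous.comp (continuous_const.mul continuous_id)
    have e3 : Continuous fun x : ℝ => b (ε * x) :=
      hb.continuous.comp (continuous_const.mul continuous_id)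
    have e4 := hΦ.continuous
    have e5 := hΦ'.continuous
    have e6 := hΦ''.continuous
    simp only [D]
    fun_prop
  have hcbx : ∀ ε, Continuous fun x => b (ε * x) := fun ε =>
    hb.continuous.comp (continuous_const.mul continuous_id)
  have hb0 : b 0 = 1 := b.one_of_mem_closedBall (by simp [b])
  have hmem : ∀ᶠ ε : ℝ in 𝓝[>] 0, ε ∈ Ioo (0 : ℝ) 1 := Ioo_mem_nhdsGT one_pos
  have lim1 : Tendsto (fun ε : ℝ => ∫ x, (1 / 2 * D ε x - c * (b (ε * x) * Φ x)) • g x) (𝓝[>] 0)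
      (𝓝 (∫ x, (1 / 2 * deriv (deriv Φ) x - c * Φ x) • g x)) := by
    refine tendsto_integral_filter_of_dominated_convergence
      (fun x => (1 / 2 * M₂ + |c| * M₀) * ‖Φ x • g x‖ + M₁ * ‖deriv Φ x • g x‖ +
        1 / 2 * M₀ * ‖deriv (deriv Φ) x • g x‖) ?_ ?_ ?_ ?_
    · refine Eventually.of_forall fun ε => AEStronglyMeasurable.fun_smul ?_ hg
      have := hcx ε
      have := hcbx ε
      have := hΦ.continuous
      exact Continuous.aestronglyMeasurable (by fun_prop)
    · filter_upwards [hmem] with ε hε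
      refine ae_of_all _ fun x => ?_
      simp only [norm_smul]
      have hεa : |ε| ≤ 1 := by rw [abs_of_pos hε.1]; exact hε.2.le
      have e0 := hM₀ (ε * x)
      have e1 := hM₁ (ε * x)
      have e2 := hM₂ (ε * x)
      simp only [Real.norm_eq_abs] at e0 e1 e2 ⊢
      have t1 : |1 / 2 * D ε x - c * (b (ε * x) * Φ x)| ≤
          1 / 2 * (1 ^ 2 * M₂ * |Φ x| + 2 * 1 * M₁ * |deriv Φ x| + M₀ * |deriv (deriv Φ) x|) +
            |c| * (M₀ * |Φ x|) := by
        refine (abs_sub _ _).trans ?_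
        rw [abs_mul, abs_mul c, abs_mul (b _), abs_of_pos (by norm_num : (0 : ℝ) < 1 / 2)]
        gcongr
        refine (abs_add_three _ _ _).trans ?_
        rw [abs_mul, abs_mul, abs_mul, abs_mul, abs_mul, abs_mul, abs_pow, abs_two]
        gcongr
      calc _ ≤ _ := mul_le_mul_of_nonneg_right t1 (norm_nonneg _)
        _ = _ := by ring
    · exact ((h0.norm.const_mul _).add (h1.norm.const_mul _)).add (h2.norm.const_mul _)
    · refine ae_of_all _ fun x => ?_
      have : Continuous fun ε : ℝ => (1 / 2 * D ε x - c * (b (ε * x) * Φ x)) • g x := by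
        have := hcont x
        have := hcb x
        fun_prop
      have := (this.tendsto 0).mono_left (nhdsWithin_le_nhds (s := Ioi 0))
      simpa [D, hb0] using this
  have lim2 : Tendsto (fun ε : ℝ => ∫ x, (b (ε * x) * Φ x) • h x) (𝓝[>] 0)
      (𝓝 (∫ x, Φ x • h x)) := by
    refine tendsto_integral_filter_of_dominated_convergence (fun x => M₀ * ‖Φ x • h x‖) ?_ ?_ ?_ ?_
    · exact Eventually.of_forall fun ε =>
        ((hcbx ε).mul hΦ.continuous).aestronglyMeasurable.smul hh
    · refine Eventually.of_forall fun ε => ae_of_all _ fun x => ?_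
      rw [mul_smul, norm_smul]
      exact mul_le_mul_of_nonneg_right (hM₀ _) (norm_nonneg _)
    · exact h3.norm.const_mul _
    · refine ae_of_all _ fun x => ?_
      have : Continuous fun ε : ℝ => (b (ε * x) * Φ x) • h x := by
        have := hcb x
        fun_prop
      have := (this.tendsto 0).mono_left (nhdsWithin_le_nhds (s := Ioi 0))
      simpa [hb0] using this
  refine tendsto_nhds_unique lim1 (lim2.congr' ?_)
  filter_upwards [self_mem_nhdsWithin] with ε hε
  exact (key ε hε).symm

lemma integrable_schwartz_smul (φ : 𝓢(ℝ, ℝ)) (g : Lp ℂ 2 (volume : Measure ℝ)) :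
    Integrable fun x => φ x • g x :=
  memLp_one_iff_integrable.1 ((Lp.memLp g).smul (φ.memLp 2))

lemma weak_equation_schwartz_real {g h : Lp ℂ 2 (volume : Measure ℝ)} {c : ℝ}
    (H : ∀ φ : ℝ → ℝ, ContDiff ℝ ((⊤ : ℕ∞) : WithTop ℕ∞) φ → HasCompactSupport φ →
      ∫ x, (1 / 2 * deriv (deriv φ) x - c * φ x) • g x = ∫ x, φ x • h x) (φ : 𝓢(ℝ, ℝ)) :
    ∫ x, (1 / 2 * deriv (deriv φ) x - c * φ x) • g x = ∫ x, φ x • h x := by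
  have e : deriv φ = SchwartzMap.derivCLM ℝ ℝ φ := rfl
  refine weak_equation_of_integrable H (φ.smooth ⊤) (integrable_schwartz_smul φ g) ?_ ?_
    (integrable_schwartz_smul φ h) (Lp.memLp g).1 (Lp.memLp h).1
  · exact integrable_schwartz_smul (SchwartzMap.derivCLM ℝ ℝ φ) g
  · exact integrable_schwartz_smul (SchwartzMap.derivCLM ℝ ℝ (SchwartzMap.derivCLM ℝ ℝ φ)) g

lemma weak_equation_schwartz {g h : Lp ℂ 2 (volume : Measure ℝ)} {c : ℝ}
    (H : ∀ φ : ℝ → ℝ, ContDiff ℝ ((⊤ : ℕ∞) : WithTop ℕ∞) φ → HasCompactSupport φ →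
      ∫ x, (1 / 2 * deriv (deriv φ) x - c * φ x) • g x = ∫ x, φ x • h x) (φ : 𝓢(ℝ, ℂ)) :
    ∫ x, (1 / 2 * deriv (deriv φ) x - c * φ x) * g x = ∫ x, φ x * h x := by
  have key : ∀ (L : ℂ →L[ℝ] ℝ),
      Integrable (fun x => (L (1 / 2 * deriv (deriv φ) x - c * φ x)) • g x) ∧
      Integrable (fun x => L (φ x) • h x) ∧
      ∫ x, (L (1 / 2 * deriv (deriv φ) x - c * φ x)) • g x = ∫ x, L (φ x) • h x := by
    intro L
    have e1 : deriv (φ.postcompCLM L) = fun x => L (deriv φ x) := by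
      funext x
      exact (L.hasFDerivAt.comp_hasDerivAt x (φ.hasDerivAt x)).deriv
    have e2 : ∀ x, deriv (deriv (φ.postcompCLM L)) x = L (deriv (deriv φ) x) := by
      intro x
      rw [e1]
      exact (L.hasFDerivAt.comp_hasDerivAt x ((SchwartzMap.derivCLM ℝ ℂ φ).hasDerivAt x)).deriv
    have e3 : ∀ x, L (1 / 2 * deriv (deriv φ) x - c * φ x) =
        1 / 2 * deriv (deriv (φ.postcompCLM L)) x - c * (φ.postcompCLM L) x := by
      intro x
      rw [e2, SchwartzMap.postcompCLM_apply, map_sub]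
      have r1 : (1 / 2 : ℂ) * deriv (deriv φ) x = (1 / 2 : ℝ) • deriv (deriv φ) x := by
        rw [Complex.real_smul]; push_cast; ring
      have r2 : (c : ℂ) * φ x = c • φ x := by rw [Complex.real_smul]
      rw [r1, r2, map_smul, map_smul, smul_eq_mul, smul_eq_mul]
    have i1 := integrable_schwartz_smul (SchwartzMap.derivCLM ℝ ℝ (SchwartzMap.derivCLM ℝ ℝ
      (φ.postcompCLM L))) g
    have i2 := integrable_schwartz_smul (φ.postcompCLM L) g
    refine ⟨?_, integrable_schwartz_smul (φ.postcompCLM L) h, ?_⟩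
    · refine ((i1.smul (1 / 2 : ℝ)).sub (i2.smul c)).congr (ae_of_all _ fun x => ?_)
      simp only [e3, Pi.sub_apply, Pi.smul_apply, sub_smul, mul_smul]
      rfl
    · simp_rw [e3]
      exact weak_equation_schwartz_real H (φ.postcompCLM L)
  obtain ⟨a1, a2, a3⟩ := key Complex.reCLM
  obtain ⟨b1, b2, b3⟩ := key Complex.imCLM
  have split : ∀ z w : ℂ, z * w = Complex.reCLM z • w + Complex.I * (Complex.imCLM z • w) := by
    intro z w
    conv_lhs => rw [← Complex.re_add_im z]
    simp only [Complex.reCLM_apply, Complex.imCLM_apply, Complex.real_smul]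
    ring
  rw [integral_congr_ae (ae_of_all _ fun x => split _ (g x)),
    integral_congr_ae (ae_of_all _ fun x => split _ (h x)),
    integral_add a1 (b1.const_mul _), integral_add a2 (b2.const_mul _), integral_const_mul,
    integral_const_mul, a3, b3]

/-- A weak solution in `L²(ℝ)` of `½ g'' - c g = h` solves the equation on the Fourier side. -/
lemma fourier_eq_of_weak_equation {g h : Lp ℂ 2 (volume : Measure ℝ)} {c : ℝ}
    (H : ∀ φ : ℝ → ℝ, ContDiff ℝ ((⊤ : ℕ∞) : WithTop ℕ∞) φ → HasCompactSupport φ →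
      ∫ x, (1 / 2 * deriv (deriv φ) x - c * φ x) • g x = ∫ x, φ x • h x) :
    (fun x : ℝ => (-(2 * Real.pi ^ 2 * x ^ 2 + c : ℝ) : ℂ) *
      (𝓕 g : Lp ℂ 2 (volume : Measure ℝ)) x) =ᵐ[volume]
      (𝓕 h : Lp ℂ 2 (volume : Measure ℝ)) := by
  have hloc : ∀ f : Lp ℂ 2 (volume : Measure ℝ), LocallyIntegrable f := fun f =>
    (Lp.memLp f).locallyIntegrable (by norm_num)
  refine ae_eq_of_integral_contDiff_smul_eq ?_ (hloc _) ?_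
  · have hc : Continuous fun x : ℝ => (-(2 * Real.pi ^ 2 * x ^ 2 + c : ℝ) : ℂ) := by fun_prop
    exact (hloc _).continuous_mul hc
  intro θ hθ hθc
  have h1 : HasCompactSupport fun x => (θ x : ℂ) := hθc.comp_left (g := Complex.ofReal) (by simp)
  have h2 : ContDiff ℝ ((⊤ : ℕ∞) : WithTop ℕ∞) fun x => (θ x : ℂ) :=
    Complex.ofRealCLM.contDiff.comp hθ
  set ψ := h1.toSchwartzMap h2
  have hψ : ∀ x, ψ x = θ x := fun x => rfl
  have h3 := weak_equation_schwartz H (𝓕 ψ)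
  have h4 : deriv (𝓕 ψ : 𝓢(ℝ, ℂ)) = (𝓕 (mulX ψ) : 𝓢(ℝ, ℂ)) := by
    funext x
    exact (fourier_mulX ψ x).symm
  have h5 : ∀ x, (1 / 2 * deriv (deriv (𝓕 ψ : 𝓢(ℝ, ℂ))) x - c * (𝓕 ψ : 𝓢(ℝ, ℂ)) x) =
      (𝓕 ((1 / 2 : ℂ) • mulX (mulX ψ) - (c : ℂ) • ψ) : 𝓢(ℝ, ℂ)) x := by
    intro x
    rw [h4, ← fourier_mulX, sub_eq_add_neg ((1 / 2 : ℂ) • mulX (mulX ψ)), ← neg_smul,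
      FourierTransform.fourier_add, FourierTransform.fourier_smul,
      FourierTransform.fourier_smul, add_apply, smul_apply, smul_apply, smul_eq_mul, smul_eq_mul]
    ring
  simp_rw [h5] at h3
  simp_rw [← smul_eq_mul] at h3
  rw [← integral_smul_fourier, ← integral_smul_fourier] at h3
  refine Eq.trans (integral_congr_ae (ae_of_all _ fun x => ?_)) (h3.trans
    (integral_congr_ae (ae_of_all _ fun x => ?_)))
  · simp only [sub_apply, smul_apply, mulX_apply, hψ, smul_eq_mul,
      Complex.real_smul]
    push_cast
    linear_combination (-2 * (Real.pi : ℂ) ^ 2 * x ^ 2 * θ x *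
      (𝓕 g : Lp ℂ 2 (volume : Measure ℝ)) x) * Complex.I_sq
  · simp only [hψ, smul_eq_mul, Complex.real_smul]

end L2Fourier

/-! ### The substitution `x = exp (σ z)` -/

section Substitution

variable {σ : ℝ}

lemma image_exp_mul (hσ : 0 < σ) : (fun z => Real.exp (σ * z)) '' univ = Ioi 0 := by
  ext x
  constructor
  · rintro ⟨z, -, rfl⟩
    exact Real.exp_pos _
  · intro hx
    refine ⟨Real.log x / σ, mem_univ _, ?_⟩
    simp only
    rw [mul_div_cancel₀ _ hσ.ne', Real.exp_log hx]

lemma hasDerivAt_exp_mul (σ z : ℝ) :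
    HasDerivAt (fun z => Real.exp (σ * z)) (σ * Real.exp (σ * z)) z := by
  have := ((hasDerivAt_id z).const_mul σ).exp
  simpa [mul_comm] using this

lemma exp_mul_injective (hσ : 0 < σ) : Function.Injective fun z => Real.exp (σ * z) := by
  intro a b hab
  exact mul_left_cancel₀ hσ.ne' (Real.exp_injective hab)

lemma log_exp_mul_div (hσ : 0 < σ) (z : ℝ) : Real.log (Real.exp (σ * z)) / σ = z := by
  rw [Real.log_exp, mul_div_cancel_left₀ _ hσ.ne']

lemma exp_mul_log_div (hσ : 0 < σ) {x : ℝ} (hx : 0 < x) :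
    Real.exp (σ * (Real.log x / σ)) = x := by
  rw [mul_div_cancel₀ _ hσ.ne', Real.exp_log hx]

lemma ae_Ioi_iff_ae_exp (hσ : 0 < σ) (p : ℝ → Prop) :
    (∀ᵐ x : ℝ, x ∈ Ioi (0 : ℝ) → p x) ↔ ∀ᵐ z : ℝ, p (Real.exp (σ * z)) := by
  simp only [ae_iff]
  constructor
  · intro h
    have h1 : {z | ¬ p (Real.exp (σ * z))} =
        (fun x => Real.log x / σ) '' {x | ¬ (x ∈ Ioi 0 → p x)} := by
      ext z
      constructor
      · intro hz
        exact ⟨Real.exp (σ * z), by simpa using ⟨Real.exp_pos _, hz⟩, log_exp_mul_div hσ z⟩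
      · rintro ⟨x, hx, rfl⟩
        simp only [mem_Ioi, Classical.not_imp, mem_ofPred_eq] at hx ⊢
        rw [exp_mul_log_div hσ hx.1]
        exact hx.2
    rw [h1]
    refine addHaar_image_eq_zero_of_differentiableOn_of_addHaar_eq_zero _ ?_ h
    intro x hx
    simp only [mem_Ioi, Classical.not_imp, mem_ofPred_eq] at hx
    exact ((Real.differentiableAt_log hx.1.ne').div_const _).differentiableWithinAt
  · intro h
    have h1 : {x | ¬ (x ∈ Ioi 0 → p x)} =
        (fun z => Real.exp (σ * z)) '' {z | ¬ p (Real.exp (σ * z))} := by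
      ext x
      constructor
      · intro hx
        simp only [mem_Ioi, Classical.not_imp, mem_ofPred_eq] at hx
        refine ⟨Real.log x / σ, ?_, exp_mul_log_div hσ hx.1⟩
        simpa only [mem_ofPred_eq, exp_mul_log_div hσ hx.1] using hx.2
      · rintro ⟨z, hz, rfl⟩
        simpa using ⟨Real.exp_pos _, hz⟩
    rw [h1]
    exact addHaar_image_eq_zero_of_differentiableOn_of_addHaar_eq_zero _
      (fun z _ => (hasDerivAt_exp_mul σ z).differentiableAt.differentiableWithinAt) h

lemma integral_Ioi_eq_integral_exp {F : Type*} [NormedAddCommGroup F] [NormedSpace ℝ F]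
    (hσ : 0 < σ) (g : ℝ → F) :
    ∫ x in Ioi 0, g x = ∫ z, (σ * Real.exp (σ * z)) • g (Real.exp (σ * z)) := by
  rw [← image_exp_mul hσ, integral_image_eq_integral_abs_deriv_smul MeasurableSet.univ
    (fun z _ => (hasDerivAt_exp_mul σ z).hasDerivWithinAt) (exp_mul_injective hσ).injOn,
    setIntegral_univ]
  refine integral_congr_ae (ae_of_all _ fun z => ?_)
  simp only
  rw [abs_of_pos (by positivity)]

lemma lintegral_Ioi_eq_lintegral_exp (hσ : 0 < σ) (g : ℝ → ENNReal) :
    ∫⁻ x in Ioi 0, g x =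
      ∫⁻ z, ENNReal.ofReal (σ * Real.exp (σ * z)) * g (Real.exp (σ * z)) := by
  rw [← image_exp_mul hσ, lintegral_image_eq_lintegral_abs_deriv_mul MeasurableSet.univ
    (fun z _ => (hasDerivAt_exp_mul σ z).hasDerivWithinAt) (exp_mul_injective hσ).injOn,
    Measure.restrict_univ]
  refine lintegral_congr fun z => ?_
  rw [abs_of_pos (by positivity)]

lemma integrableOn_image_exp_iff {F : Type*} [NormedAddCommGroup F] [NormedSpace ℝ F]
    (hσ : 0 < σ) {K : Set ℝ} (hK : MeasurableSet K) (g : ℝ → F) :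
    IntegrableOn g ((fun z => Real.exp (σ * z)) '' K) ↔
      IntegrableOn (fun z => (σ * Real.exp (σ * z)) • g (Real.exp (σ * z))) K := by
  rw [integrableOn_image_iff_integrableOn_abs_deriv_smul hK
    (fun z _ => (hasDerivAt_exp_mul σ z).hasDerivWithinAt) (exp_mul_injective hσ).injOn]
  simp_rw [abs_of_pos (mul_pos hσ (Real.exp_pos _))]

lemma continuous_exp_mul (σ : ℝ) : Continuous fun z => Real.exp (σ * z) := by fun_prop

lemma locallyIntegrable_comp_exp (hσ : 0 < σ) {u : ℝ → ℂ} (hu : LocallyIntegrableOn u (Ioi 0)) :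
    LocallyIntegrable fun z => u (Real.exp (σ * z)) := by
  rw [locallyIntegrable_iff]
  intro K hK
  have h1 : IntegrableOn u ((fun z => Real.exp (σ * z)) '' K) := by
    refine hu.integrableOn_compact_subset ?_ (hK.image (continuous_exp_mul σ))
    rintro _ ⟨z, -, rfl⟩
    exact Real.exp_pos _
  rw [integrableOn_image_exp_iff hσ hK.measurableSet] at h1
  have hc : Continuous fun z => (σ * Real.exp (σ * z))⁻¹ :=
    (continuous_const.mul (continuous_exp_mul σ)).inv₀ fun z =>
      (mul_pos hσ (Real.exp_pos _)).ne'
  refine (h1.continuousOn_smul hc.continuousOn hK).congr_fun (fun z _ => ?_) hK.measurableSet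
  simp only
  rw [inv_smul_smul₀ (by positivity)]

lemma locallyIntegrableOn_comp_log (hσ : 0 < σ) {v : ℝ → ℂ} (hv : LocallyIntegrable v) :
    LocallyIntegrableOn (fun x => v (Real.log x / σ)) (Ioi 0) := by
  rw [locallyIntegrableOn_iff isOpen_Ioi.isLocallyClosed]
  intro K hK hKc
  have hlog : ContinuousOn (fun x => Real.log x / σ) K :=
    (Real.continuousOn_log.mono fun x hx => (hK hx : (0 : ℝ) < x).ne').div_const _
  have hL := hKc.image_of_continuousOn hlog
  have h1 : (fun z => Real.exp (σ * z)) '' ((fun x => Real.log x / σ) '' K) = K := by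
    rw [image_image]
    ext x
    constructor
    · rintro ⟨y, hy, rfl⟩
      simp only
      rwa [exp_mul_log_div hσ (hK hy)]
    · exact fun hx => ⟨x, hx, exp_mul_log_div hσ (hK hx)⟩
  rw [← h1, integrableOn_image_exp_iff hσ hL.measurableSet]
  simp_rw [log_exp_mul_div hσ]
  exact (hv.integrableOn_isCompact hL).continuousOn_smul
    (continuous_const.mul (continuous_exp_mul σ)).continuousOn hL

lemma integral_testFunction_smul_eq {φ : ℝ → ℝ} (hσ : 0 < σ) (hs : tsupport φ ⊆ Ioi 0)
    (u : ℝ → ℂ) : ∫ x, φ x • u x =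
      ∫ z, (σ * Real.exp (σ * z)) • (φ (Real.exp (σ * z)) • u (Real.exp (σ * z))) := by
  rw [← integral_Ioi_eq_integral_exp hσ fun x => φ x • u x]
  refine (setIntegral_eq_integral_of_forall_compl_eq_zero fun x hx => ?_).symm
  rw [image_eq_zero_of_notMem_tsupport fun h => hx (hs h), zero_smul]

end Substitution

/-! ### Weak derivatives on the line and on the half-line -/

/-- `v` is the weak derivative of `u` on the line. -/
def HasWeakDeriv (u v : ℝ → ℂ) : Prop :=
  LocallyIntegrable u ∧ LocallyIntegrable v ∧
    ∀ φ : ℝ → ℝ, ContDiff ℝ ((⊤ : ℕ∞) : WithTop ℕ∞) φ → HasCompactSupport φ →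
      ∫ x, deriv φ x • u x = -∫ x, φ x • v x

lemma MeasureTheory.LocallyIntegrable.integrable_testFunction_smul {u : ℝ → ℂ}
    (hu : LocallyIntegrable u) {φ : ℝ → ℝ} (hφ : Continuous φ) (hc : HasCompactSupport φ) :
    Integrable fun x => φ x • u x :=
  hu.integrable_smul_left_of_hasCompactSupport hφ hc

lemma HasWeakDeriv.add {u v u' v' : ℝ → ℂ} (h : HasWeakDeriv u v) (h' : HasWeakDeriv u' v') :
    HasWeakDeriv (fun x => u x + u' x) (fun x => v x + v' x) := by
  refine ⟨h.1.add h'.1, h.2.1.add h'.2.1, fun φ hφ hc => ?_⟩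
  have hφ' : Continuous (deriv φ) := (contDiff_infty_iff_deriv.1 hφ).2.continuous
  simp only [smul_add]
  rw [integral_add (h.1.integrable_testFunction_smul hφ' hc.deriv)
      (h'.1.integrable_testFunction_smul hφ' hc.deriv),
    integral_add (h.2.1.integrable_testFunction_smul hφ.continuous hc)
      (h'.2.1.integrable_testFunction_smul hφ.continuous hc),
    h.2.2 φ hφ hc, h'.2.2 φ hφ hc, neg_add]

/-- The Leibniz rule for the product with a smooth function. -/
lemma HasWeakDeriv.smooth_smul {u v : ℝ → ℂ} (h : HasWeakDeriv u v) {w w' : ℝ → ℝ}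
    (hw : ContDiff ℝ ((⊤ : ℕ∞) : WithTop ℕ∞) w) (hd : ∀ x, HasDerivAt w (w' x) x) :
    HasWeakDeriv (fun x => w x • u x) (fun x => w' x • u x + w x • v x) := by
  have hw'e : w' = deriv w := funext fun x => (hd x).deriv.symm
  have hw' : Continuous w' := hw'e ▸ (contDiff_infty_iff_deriv.1 hw).2.continuous
  refine ⟨h.1.continuous_smul hw.continuous,
    (h.1.continuous_smul hw').add (h.2.1.continuous_smul hw.continuous), ?_⟩
  intro φ hφ hc
  have hφd : ∀ x, HasDerivAt φ (deriv φ x) x := fun x =>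
    (hφ.differentiable (by simp)).differentiableAt.hasDerivAt
  have h1 := h.2.2 (fun x => φ x * w x) (hφ.mul hw) hc.mul_right
  have h2 : ∀ x, deriv (fun x => φ x * w x) x = deriv φ x * w x + φ x * w' x := fun x =>
    ((hφd x).mul (hd x)).deriv
  have hφ' : Continuous (deriv φ) := (contDiff_infty_iff_deriv.1 hφ).2.continuous
  have i1 : Integrable fun x => (deriv φ x * w x) • u x :=
    h.1.integrable_testFunction_smul (hφ'.mul hw.continuous) hc.deriv.mul_right
  have i2 : Integrable fun x => (φ x * w' x) • u x :=
    h.1.integrable_testFunction_smul (hφ.continuous.mul hw') hc.mul_right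
  have i3 : Integrable fun x => (φ x * w x) • v x :=
    h.2.1.integrable_testFunction_smul (hφ.continuous.mul hw.continuous) hc.mul_right
  simp_rw [h2, add_smul] at h1
  rw [integral_add i1 i2] at h1
  simp_rw [smul_add, ← mul_smul]
  rw [integral_add i2 i3, neg_add, ← h1]
  ring

/-- The chain rule for the substitution `x = exp (σ z)`. -/
lemma HasWeakDerivOnHalfLine.comp_exp {σ : ℝ} (hσ : 0 < σ) {u v : ℝ → ℂ}
    (h : HasWeakDerivOnHalfLine u v) :
    HasWeakDeriv (fun z => u (Real.exp (σ * z)))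
      (fun z => (σ * Real.exp (σ * z)) • v (Real.exp (σ * z))) := by
  refine ⟨locallyIntegrable_comp_exp hσ h.1, (locallyIntegrable_comp_exp hσ h.2.1).continuous_smul
    (continuous_const.mul (continuous_exp_mul σ)), ?_⟩
  intro θ hθ hc
  -- the indicator is needed because `Real.log` is `log |x|` on the negative half-line
  set Ψ : ℝ → ℝ := (Ioi 0).indicator fun x => θ (Real.log x / σ) with hΨ
  have hsub : tsupport Ψ ⊆ (fun z => Real.exp (σ * z)) '' tsupport θ := by
    refine closure_minimal ?_ (hc.isCompact.image (continuous_exp_mul σ)).isClosed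
    intro x hx
    have hx0 : x ∈ Ioi (0 : ℝ) := by
      by_contra h0
      exact hx (indicator_of_notMem h0 _)
    refine ⟨Real.log x / σ, subset_tsupport _ ?_, exp_mul_log_div hσ hx0⟩
    rwa [Function.mem_support, hΨ, indicator_of_mem hx0] at hx
  have hs : tsupport Ψ ⊆ Ioi 0 := by
    refine hsub.trans ?_
    rintro _ ⟨z, -, rfl⟩
    exact Real.exp_pos _
  have hΨc : HasCompactSupport Ψ :=
    (hc.isCompact.image (continuous_exp_mul σ)).of_isClosed_subset (isClosed_tsupport _) hsub
  have hev : ∀ x : ℝ, 0 < x → Ψ =ᶠ[𝓝 x] fun x => θ (Real.log x / σ) := fun x hx => by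
    filter_upwards [Ioi_mem_nhds hx] with y hy
    exact indicator_of_mem hy _
  have hΨs : ContDiff ℝ ((⊤ : ℕ∞) : WithTop ℕ∞) Ψ := by
    refine contDiff_iff_contDiffAt.2 fun x => ?_
    by_cases hx : x ∈ tsupport Ψ
    swap
    · exact contDiffAt_const.congr_of_eventuallyEq (notMem_tsupport_iff_eventuallyEq.1 hx)
    refine ContDiffAt.congr_of_eventuallyEq ?_ (hev x (hs hx))
    exact hθ.contDiffAt.comp x ((Real.contDiffAt_log.2 (hs hx : (0 : ℝ) < x).ne').div_const σ)
  have hΨd : ∀ z, (σ * Real.exp (σ * z)) * deriv Ψ (Real.exp (σ * z)) = deriv θ z := fun z => by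
    have e := Real.exp_pos (σ * z)
    have h1 : HasDerivAt (fun x => θ (Real.log x / σ))
        (deriv θ z * ((Real.exp (σ * z))⁻¹ / σ)) (Real.exp (σ * z)) := by
      refine HasDerivAt.comp (h₂ := θ) _ ?_ ((Real.hasDerivAt_log e.ne').div_const σ)
      rw [log_exp_mul_div hσ]
      exact (hθ.differentiable (by simp)).differentiableAt.hasDerivAt
    rw [(hev _ e).deriv_eq, h1.deriv]
    field_simp
  have hΨe : ∀ z, Ψ (Real.exp (σ * z)) = θ z := fun z => by
    rw [hΨ, indicator_of_mem (mem_Ioi.2 (Real.exp_pos _)), log_exp_mul_div hσ]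
  have key := h.2.2 Ψ hΨs hΨc hs
  rw [integral_testFunction_smul_eq hσ (tsupport_deriv_subset.trans hs),
    integral_testFunction_smul_eq hσ hs] at key
  simp_rw [← mul_smul _ (deriv Ψ _), hΨd, hΨe] at key
  rw [key]
  simp_rw [smul_comm (θ _)]

/-- The chain rule for the substitution `z = (log x) / σ`. -/
lemma HasWeakDeriv.comp_log {σ : ℝ} (hσ : 0 < σ) {u v : ℝ → ℂ}
    (h : HasWeakDeriv u fun z => (σ * Real.exp (σ * z)) • v z) :
    HasWeakDerivOnHalfLine (fun x => u (Real.log x / σ)) (fun x => v (Real.log x / σ)) := by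
  have hv : LocallyIntegrable v := by
    have hE : Continuous fun z => (σ * Real.exp (σ * z))⁻¹ :=
      (continuous_const.mul (continuous_exp_mul σ)).inv₀ fun z =>
        (mul_pos hσ (Real.exp_pos _)).ne'
    refine (h.2.1.continuous_smul hE).congr (ae_of_all _ fun z => ?_)
    exact inv_smul_smul₀ (mul_pos hσ (Real.exp_pos _)).ne' _
  refine ⟨locallyIntegrableOn_comp_log hσ h.1, locallyIntegrableOn_comp_log hσ hv, ?_⟩
  intro φ hφ hc hs
  have hsub : tsupport (fun z => φ (Real.exp (σ * z))) ⊆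
      (fun x => Real.log x / σ) '' tsupport φ := by
    have hlog : ContinuousOn (fun x => Real.log x / σ) (tsupport φ) :=
      (Real.continuousOn_log.mono fun x hx => (hs hx : (0 : ℝ) < x).ne').div_const _
    refine closure_minimal ?_ (hc.isCompact.image_of_continuousOn hlog).isClosed
    intro z hz
    exact ⟨Real.exp (σ * z), subset_tsupport _ hz, log_exp_mul_div hσ z⟩
  have hlog : ContinuousOn (fun x => Real.log x / σ) (tsupport φ) :=
    (Real.continuousOn_log.mono fun x hx => (hs hx : (0 : ℝ) < x).ne').div_const _
  have hθc : HasCompactSupport fun z => φ (Real.exp (σ * z)) :=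
    (hc.isCompact.image_of_continuousOn hlog).of_isClosed_subset (isClosed_tsupport _) hsub
  have hθ : ContDiff ℝ ((⊤ : ℕ∞) : WithTop ℕ∞) fun z => φ (Real.exp (σ * z)) :=
    hφ.comp (Real.contDiff_exp.comp (contDiff_const.mul contDiff_id))
  have hθd : ∀ z, deriv (fun z => φ (Real.exp (σ * z))) z =
      σ * Real.exp (σ * z) * deriv φ (Real.exp (σ * z)) := fun z => by
    have := HasDerivAt.comp z ((hφ.differentiable (by simp)).differentiableAt.hasDerivAt)
      (hasDerivAt_exp_mul σ z)
    rw [mul_comm]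
    exact this.deriv
  have key := h.2.2 _ hθ hθc
  rw [integral_testFunction_smul_eq hσ (tsupport_deriv_subset.trans hs),
    integral_testFunction_smul_eq hσ hs]
  simp_rw [log_exp_mul_div hσ, ← mul_smul _ (deriv φ _), ← hθd]
  rw [key]
  congr 1
  refine integral_congr_ae (ae_of_all _ fun z => ?_)
  simp only
  rw [smul_comm (φ _)]

/-! ### The unitary map to `L²(ℝ)` -/

namespace GBM

variable (μ k : ℝ) {σ : ℝ}

/-- The square root of the density of the speed measure with respect to the Lamperti coordinate
`z = (log x) / σ`. -/
noncomputable def amp (μ k σ z : ℝ) : ℝ := Real.sqrt (2 / σ) * Real.exp (xi μ k σ * z)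

lemma amp_pos (hσ : 0 < σ) (z : ℝ) : 0 < amp μ k σ z := by
  unfold amp
  positivity

lemma contDiff_amp (μ k σ : ℝ) : ContDiff ℝ ((⊤ : ℕ∞) : WithTop ℕ∞) (amp μ k σ) :=
  contDiff_const.mul (Real.contDiff_exp.comp (contDiff_const.mul contDiff_id))

lemma hasDerivAt_amp (μ k σ z : ℝ) : HasDerivAt (amp μ k σ) (xi μ k σ * amp μ k σ z) z := by
  have := (((hasDerivAt_id z).const_mul (xi μ k σ)).exp).const_mul (Real.sqrt (2 / σ))
  refine this.congr_deriv ?_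
  simp only [amp, id]
  ring

lemma amp_sq (hσ : 0 < σ) (z : ℝ) :
    amp μ k σ z ^ 2 = 2 / σ * Real.exp (2 * xi μ k σ * z) := by
  rw [amp, mul_pow, Real.sq_sqrt (by positivity), ← Real.exp_nat_mul]
  congr 2
  push_cast
  ring

lemma speedDensity_exp_mul (hσ : 0 < σ) (z : ℝ) :
    speedDensity μ k σ (Real.exp (σ * z)) * (σ * Real.exp (σ * z)) = amp μ k σ z ^ 2 := by
  rw [amp_sq μ k hσ, speedDensity, Real.log_exp]
  have : 2 * xi μ k σ * (1 / σ) * (σ * z) = 2 * xi μ k σ * z := by field_simp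
  rw [this]
  field_simp

/-- The function `a(z) f(exp (σ z))`, where `a` is `amp`. -/
noncomputable def pullback (μ k σ : ℝ) (f : ℝ → ℂ) (z : ℝ) : ℂ :=
  (amp μ k σ z : ℂ) * f (Real.exp (σ * z))

lemma ae_speedMeasure_iff_ae_exp (hσ : 0 < σ) (p : ℝ → Prop) :
    (∀ᵐ x ∂speedMeasure μ k σ, p x) ↔ ∀ᵐ z : ℝ, p (Real.exp (σ * z)) := by
  rw [ae_speedMeasure_iff μ k hσ, ae_Ioi_iff_ae_exp hσ]

lemma pullback_congr (hσ : 0 < σ) {f g : ℝ → ℂ} (h : f =ᵐ[speedMeasure μ k σ] g) :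
    pullback μ k σ f =ᵐ[volume] pullback μ k σ g := by
  filter_upwards [(ae_speedMeasure_iff_ae_exp μ k hσ _).1 h] with z hz
  rw [pullback, pullback, hz]

lemma aestronglyMeasurable_pullback_iff (hσ : 0 < σ) (f : ℝ → ℂ) :
    AEStronglyMeasurable (pullback μ k σ f) volume ↔
      AEStronglyMeasurable f (speedMeasure μ k σ) := by
  have ha : Measurable fun z => (amp μ k σ z : ℂ) :=
    Complex.measurable_ofReal.comp (contDiff_amp μ k σ).continuous.measurable
  constructor
  · rintro ⟨g, hg, hfg⟩
    refine ⟨fun x => g (Real.log x / σ) / amp μ k σ (Real.log x / σ), ?_, ?_⟩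
    · exact ((hg.measurable.div ha).comp (Real.measurable_log.div_const σ)).stronglyMeasurable
    · refine (ae_speedMeasure_iff_ae_exp μ k hσ _).2 ?_
      filter_upwards [hfg] with z hz
      have := (amp_pos μ k hσ z).ne'
      rw [log_exp_mul_div hσ, ← hz, pullback, mul_div_cancel_left₀ _ (by exact_mod_cast this)]
  · rintro ⟨g, hg, hfg⟩
    refine ⟨pullback μ k σ g, ?_, pullback_congr μ k hσ hfg⟩
    exact (ha.mul (hg.measurable.comp (continuous_exp_mul σ).measurable)).stronglyMeasurable

lemma eLpNorm_pullback (hσ : 0 < σ) (f : ℝ → ℂ) :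
    eLpNorm (pullback μ k σ f) 2 volume = eLpNorm f 2 (speedMeasure μ k σ) := by
  rw [eLpNorm_eq_lintegral_rpow_enorm_toReal (by norm_num) (by norm_num),
    eLpNorm_eq_lintegral_rpow_enorm_toReal (by norm_num) (by norm_num), speedMeasure,
    lintegral_withDensity_eq_lintegral_mul_non_measurable _
      (measurable_speedDensity μ k σ).ennreal_ofReal (by simp),
    lintegral_Ioi_eq_lintegral_exp hσ]
  congr 1
  refine lintegral_congr fun z => ?_
  have h0 : (0 : ℝ) ≤ σ * Real.exp (σ * z) := by positivity
  rw [Pi.mul_apply, ← mul_assoc, ← ENNReal.ofReal_mul h0, mul_comm (σ * _),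
    speedDensity_exp_mul μ k hσ, pullback, enorm_mul, ENNReal.mul_rpow_of_nonneg _ _ (by norm_num)]
  congr 1
  rw [← ofReal_norm, Complex.norm_real, Real.norm_of_nonneg (amp_pos μ k hσ z).le,
    ENNReal.toReal_ofNat, ENNReal.rpow_ofNat, ENNReal.ofReal_pow (amp_pos μ k hσ z).le]

lemma memLp_pullback_iff (hσ : 0 < σ) (f : ℝ → ℂ) :
    MemLp (pullback μ k σ f) 2 volume ↔ MemLp f 2 (speedMeasure μ k σ) := by
  rw [MemLp, MemLp, aestronglyMeasurable_pullback_iff μ k hσ, eLpNorm_pullback μ k hσ]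

/-- The map `f ↦ a(z) f(exp (σ z))` as an isometry from `L²(m)` into `L²(ℝ)`. -/
noncomputable def lampertiIsometry (hσ : 0 < σ) :
    HilbertSpace μ k σ →ₗᵢ[ℂ] Lp ℂ 2 (volume : Measure ℝ) where
  toFun f := ((memLp_pullback_iff μ k hσ f).2 (Lp.memLp f)).toLp _
  map_add' f g := by
    rw [← MemLp.toLp_add]
    refine MemLp.toLp_congr _ _ ((pullback_congr μ k hσ (Lp.coeFn_add f g)).trans ?_)
    refine ae_of_all _ fun z => ?_
    simp only [pullback, Pi.add_apply, mul_add]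
  map_smul' c f := by
    rw [RingHom.id_apply, ← MemLp.toLp_const_smul]
    refine MemLp.toLp_congr _ _ ((pullback_congr μ k hσ (Lp.coeFn_smul c f)).trans ?_)
    refine ae_of_all _ fun z => ?_
    simp only [pullback, Pi.smul_apply, smul_eq_mul]
    ring
  norm_map' f := by
    simp only [LinearMap.coe_mk, AddHom.coe_mk]
    rw [Lp.norm_toLp, eLpNorm_pullback μ k hσ, Lp.norm_def]

lemma coeFn_lampertiIsometry (hσ : 0 < σ) (f : HilbertSpace μ k σ) :
    lampertiIsometry μ k hσ f =ᵐ[volume] pullback μ k σ f :=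
  ((memLp_pullback_iff μ k hσ f).2 (Lp.memLp f)).coeFn_toLp

lemma lampertiIsometry_surjective (hσ : 0 < σ) :
    Function.Surjective (lampertiIsometry μ k hσ) := by
  intro g
  have h1 : pullback μ k σ (fun x => g (Real.log x / σ) / amp μ k σ (Real.log x / σ)) = g := by
    funext z
    have := (amp_pos μ k hσ z).ne'
    rw [pullback, log_exp_mul_div hσ, mul_div_cancel₀ _ (by exact_mod_cast this)]
  have h2 := (memLp_pullback_iff μ k hσ _).1 (h1 ▸ Lp.memLp g)
  refine ⟨h2.toLp, Lp.ext ?_⟩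
  refine (coeFn_lampertiIsometry μ k hσ _).trans ((pullback_congr μ k hσ h2.coeFn_toLp).trans ?_)
  rw [h1]

/-- The Lamperti transform `f ↦ a(z) f(exp (σ z))` as a unitary map from `L²(m)` onto `L²(ℝ)`. -/
noncomputable def lamperti (hσ : 0 < σ) :
    HilbertSpace μ k σ ≃ₗᵢ[ℂ] Lp ℂ 2 (volume : Measure ℝ) :=
  LinearIsometryEquiv.ofSurjective _ (lampertiIsometry_surjective μ k hσ)

lemma coeFn_lamperti (hσ : 0 < σ) (f : HilbertSpace μ k σ) :
    lamperti μ k hσ f =ᵐ[volume] pullback μ k σ f :=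
  coeFn_lampertiIsometry μ k hσ f

/-! ### Diagonalization of the generator -/

lemma drift_eq (hσ : 0 < σ) : (μ + k : ℂ) = σ * xi μ k σ + σ ^ 2 / 2 := by
  have : μ + k = σ * xi μ k σ + σ ^ 2 / 2 := by
    rw [xi]
    field_simp
    ring
  exact_mod_cast congrArg Complex.ofReal this

lemma hasWeakDeriv_pullback (hσ : 0 < σ) {u u₁ : ℝ → ℂ} (h : HasWeakDerivOnHalfLine u u₁) :
    HasWeakDeriv (pullback μ k σ u) fun z => xi μ k σ * pullback μ k σ u z +
      σ * Real.exp (σ * z) * pullback μ k σ u₁ z := by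
  convert (h.comp_exp hσ).smooth_smul (contDiff_amp μ k σ) (hasDerivAt_amp μ k σ) using 2 with z z
  · simp [pullback]
  · simp only [pullback, Complex.real_smul]
    push_cast
    ring

/-- In the Lamperti coordinate the generator is `½ ∂² - (ξ²/2 + k)`, in the weak sense. -/
lemma weak_equation_of_mem_graph (hσ : 0 < σ) {f h : HilbertSpace μ k σ}
    (hfh : (f, h) ∈ generatorGraph μ k σ) {φ : ℝ → ℝ}
    (hφ : ContDiff ℝ ((⊤ : ℕ∞) : WithTop ℕ∞) φ) (hc : HasCompactSupport φ) :
    ∫ z, (1 / 2 * deriv (deriv φ) z - (xi μ k σ ^ 2 / 2 + k) * φ z) • lamperti μ k hσ f z =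
      ∫ z, φ z • lamperti μ k hσ h z := by
  obtain ⟨u, u₁, u₂, h1, h2, h3, h4⟩ := hfh
  set v := pullback μ k σ u
  set v₁ : ℝ → ℂ := fun z => xi μ k σ * v z + σ * Real.exp (σ * z) * pullback μ k σ u₁ z with hv₁
  have hv : HasWeakDeriv v v₁ := hasWeakDeriv_pullback μ k hσ h1
  have hw := hasWeakDeriv_pullback μ k hσ h2
  set w := pullback μ k σ u₁
  have hE : ContDiff ℝ ((⊤ : ℕ∞) : WithTop ℕ∞) fun z => σ * Real.exp (σ * z) :=
    contDiff_const.mul (Real.contDiff_exp.comp (contDiff_const.mul contDiff_id))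
  have hw' := hw.smooth_smul hE fun z => (hasDerivAt_exp_mul σ z).const_mul σ
  have hφ' : ContDiff ℝ ((⊤ : ℕ∞) : WithTop ℕ∞) (deriv φ) := (contDiff_infty_iff_deriv.1 hφ).2
  have hφ'' : Continuous (deriv (deriv φ)) := (contDiff_infty_iff_deriv.1 hφ').2.continuous
  have e1 := hv.2.2 _ hφ' hc.deriv
  have e2 := hv.2.2 _ hφ hc
  have e3 := hw'.2.2 _ hφ hc
  have i0 : Integrable fun z => φ z • v z := hv.1.integrable_testFunction_smul hφ.continuous hc
  have i0'' : Integrable fun z => deriv (deriv φ) z • v z :=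
    hv.1.integrable_testFunction_smul hφ'' hc.deriv.deriv
  have i0' : Integrable fun z => deriv φ z • v z :=
    hv.1.integrable_testFunction_smul hφ'.continuous hc.deriv
  have i1 : Integrable fun z => φ z • v₁ z := hv.2.1.integrable_testFunction_smul hφ.continuous hc
  have j0' : Integrable fun z => deriv φ z • ((σ * Real.exp (σ * z)) • w z) :=
    hw'.1.integrable_testFunction_smul hφ'.continuous hc.deriv
  have j1 := hw'.2.1.integrable_testFunction_smul hφ.continuous hc
  have e4 : ∫ z, deriv φ z • v₁ z = (xi μ k σ : ℂ) * (∫ z, deriv φ z • v z) +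
      ∫ z, deriv φ z • ((σ * Real.exp (σ * z)) • w z) := by
    rw [← integral_const_mul, ← integral_add (i0'.const_mul _) j0']
    refine integral_congr_ae (ae_of_all _ fun z => ?_)
    simp only [hv₁, Complex.real_smul]
    push_cast
    ring
  have hf : lamperti μ k hσ f =ᵐ[volume] v :=
    (coeFn_lamperti μ k hσ f).trans (pullback_congr μ k hσ h3)
  have hh : lamperti μ k hσ h =ᵐ[volume] pullback μ k σ
      fun x => diffExpr μ k σ x (u x) (u₁ x) (u₂ x) :=
    (coeFn_lamperti μ k hσ h).trans (pullback_congr μ k hσ h4)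
  have lhs : ∫ z, (1 / 2 * deriv (deriv φ) z - (xi μ k σ ^ 2 / 2 + k) * φ z) •
      lamperti μ k hσ f z = (1 / 2 : ℂ) * (∫ z, deriv (deriv φ) z • v z) -
        (xi μ k σ ^ 2 / 2 + k : ℂ) * ∫ z, φ z • v z := by
    rw [← integral_const_mul, ← integral_const_mul,
      ← integral_sub (i0''.const_mul _) (i0.const_mul _)]
    refine integral_congr_ae ?_
    filter_upwards [hf] with z hz
    rw [hz]
    simp only [Complex.real_smul]
    push_cast
    ring
  have rhs : ∫ z, φ z • lamperti μ k hσ h z = (xi μ k σ / 2 : ℂ) * (∫ z, φ z • v₁ z) +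
      (1 / 2 : ℂ) * (∫ z, φ z • ((σ * (σ * Real.exp (σ * z))) • w z + (σ * Real.exp (σ * z)) •
        (xi μ k σ * w z + σ * Real.exp (σ * z) * pullback μ k σ u₂ z))) -
        (xi μ k σ ^ 2 / 2 + k : ℂ) * ∫ z, φ z • v z := by
    rw [← integral_const_mul, ← integral_const_mul, ← integral_const_mul,
      ← integral_add (i1.const_mul _) (j1.const_mul _),
      ← integral_sub ((i1.const_mul _).fun_add (j1.const_mul _)) (i0.const_mul _)]
    refine integral_congr_ae ?_
    filter_upwards [hh] with z hz
    rw [hz]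
    have hx := drift_eq μ k hσ
    simp only [hv₁, v, w, pullback, diffExpr, Complex.real_smul]
    rw [hx]
    push_cast
    ring
  rw [lhs, rhs, e1, e4, e3, e2]
  ring

open FourierTransform in
/-- If the equation `½ G'' - (ξ²/2 + k) G = H` holds on the Fourier side for the Lamperti transforms
`G` of `f` and `H` of `h`, then `G` has two weak derivatives in `L²(ℝ)`, and the substitution
`z = (log x) / σ` turns them into weak derivatives of `f`. -/
lemma mem_graph_of_fourier_eq (hσ : 0 < σ) {f h : HilbertSpace μ k σ}
    (H : (fun x : ℝ => (-(2 * Real.pi ^ 2 * x ^ 2 + (xi μ k σ ^ 2 / 2 + k) : ℝ) : ℂ) *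
      (𝓕 (lamperti μ k hσ f) : Lp ℂ 2 (volume : Measure ℝ)) x) =ᵐ[volume]
      (𝓕 (lamperti μ k hσ h) : Lp ℂ 2 (volume : Measure ℝ))) :
    (f, h) ∈ generatorGraph μ k σ := by
  set ξ := xi μ k σ with hξ
  set c : ℝ := ξ ^ 2 / 2 + k with hc
  set G := lamperti μ k hσ f with hG
  set Z := lamperti μ k hσ h with hZ
  -- the second derivative that the equation `½ G₂ - c G = Z` prescribes
  set G₂ : Lp ℂ 2 (volume : Measure ℝ) := (2 : ℂ) • (Z + (c : ℂ) • G) with hG₂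
  have hG₂c : ∀ᵐ x : ℝ, G₂ x = 2 * (Z x + c * G x) := by
    filter_upwards [Lp.coeFn_smul (2 : ℂ) (Z + (c : ℂ) • G), Lp.coeFn_add Z ((c : ℂ) • G),
      Lp.coeFn_smul (c : ℂ) G] with x h1 h2 h3
    rw [hG₂, h1, Pi.smul_apply, h2, Pi.add_apply, h3, Pi.smul_apply, smul_eq_mul, smul_eq_mul]
  have hFG₂ : ∀ᵐ x : ℝ, (𝓕 G₂ : Lp ℂ 2 (volume : Measure ℝ)) x =
      -(2 * Real.pi * x) ^ 2 * (𝓕 G : Lp ℂ 2 (volume : Measure ℝ)) x := by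
    have e : (𝓕 G₂ : Lp ℂ 2 (volume : Measure ℝ)) = (2 : ℂ) • (𝓕 Z + (c : ℂ) • 𝓕 G) := by
      rw [hG₂, FourierTransform.fourier_smul, FourierTransform.fourier_add,
        FourierTransform.fourier_smul]
    rw [e]
    filter_upwards [H, Lp.coeFn_smul (2 : ℂ) (𝓕 Z + (c : ℂ) • 𝓕 G),
      Lp.coeFn_add (𝓕 Z) ((c : ℂ) • 𝓕 G), Lp.coeFn_smul (c : ℂ) (𝓕 G)] with x h0 h1 h2 h3
    rw [h1, Pi.smul_apply, h2, Pi.add_apply, h3, Pi.smul_apply, smul_eq_mul, smul_eq_mul, ← h0]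
    push_cast
    ring
  -- `|t y| ≤ |y| + |t² y|`, so that the first derivative is in `L²` with the second
  have hmem : MemLp (fun x : ℝ => 2 * Real.pi * Complex.I * x *
      (𝓕 G : Lp ℂ 2 (volume : Measure ℝ)) x) 2 volume := by
    have hm : Continuous fun x : ℝ => 2 * Real.pi * Complex.I * x := by fun_prop
    refine ((Lp.memLp (𝓕 G)).norm.add (Lp.memLp (𝓕 G₂)).norm).of_le
      (hm.aestronglyMeasurable.mul (Lp.memLp _).1) ?_
    filter_upwards [hFG₂] with x hx
    have e1 : ∀ y : ℂ, ‖2 * (Real.pi : ℂ) * Complex.I * x * y‖ = ‖2 * (Real.pi : ℂ) * x‖ * ‖y‖ := by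
      intro y
      simp only [norm_mul, Complex.norm_I, mul_one]
    rw [Pi.add_apply, hx, e1, Real.norm_of_nonneg (by positivity), neg_mul, norm_neg,
      norm_mul (_ ^ 2), norm_pow]
    nlinarith [mul_nonneg (norm_nonneg ((𝓕 G : Lp ℂ 2 (volume : Measure ℝ)) x))
      (sq_nonneg (‖2 * (Real.pi : ℂ) * x‖ - 1)), mul_nonneg
      (norm_nonneg ((𝓕 G : Lp ℂ 2 (volume : Measure ℝ)) x)) (sq_nonneg ‖2 * (Real.pi : ℂ) * x‖),
      norm_nonneg ((𝓕 G : Lp ℂ 2 (volume : Measure ℝ)) x)]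
  set G₁ : Lp ℂ 2 (volume : Measure ℝ) := 𝓕⁻ hmem.toLp with hG₁
  have hFG₁ : ∀ᵐ x : ℝ, 2 * Real.pi * Complex.I * x *
      (𝓕 G : Lp ℂ 2 (volume : Measure ℝ)) x = (𝓕 G₁ : Lp ℂ 2 (volume : Measure ℝ)) x := by
    rw [hG₁, fourier_fourierInv_eq]
    filter_upwards [hmem.coeFn_toLp] with x hx
    exact hx.symm
  have hFG₁₂ : ∀ᵐ x : ℝ, 2 * Real.pi * Complex.I * x *
      (𝓕 G₁ : Lp ℂ 2 (volume : Measure ℝ)) x = (𝓕 G₂ : Lp ℂ 2 (volume : Measure ℝ)) x := by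
    filter_upwards [hFG₁, hFG₂] with x h1 h2
    rw [← h1, h2]
    linear_combination (2 * (Real.pi : ℂ) * x) ^ 2 *
      (𝓕 G : Lp ℂ 2 (volume : Measure ℝ)) x * Complex.I_sq
  have hloc : ∀ f : Lp ℂ 2 (volume : Measure ℝ), LocallyIntegrable f := fun f =>
    (Lp.memLp f).locallyIntegrable (by norm_num)
  have d1 : HasWeakDeriv G G₁ :=
    ⟨hloc _, hloc _, fun φ hφ hc => L2Fourier.integral_deriv_smul_real hFG₁ hφ hc⟩
  have d2 : HasWeakDeriv G₁ G₂ :=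
    ⟨hloc _, hloc _, fun φ hφ hc => L2Fourier.integral_deriv_smul_real hFG₁₂ hφ hc⟩
  -- undo the Lamperti transform: divide by `a`, then differentiate in `x`, where `dz = E dx`
  set w : ℝ → ℝ := fun z => (amp μ k σ z)⁻¹ with hw
  have ws : ContDiff ℝ ((⊤ : ℕ∞) : WithTop ℕ∞) w :=
    (contDiff_amp μ k σ).inv fun z => (amp_pos μ k hσ z).ne'
  have wd : ∀ z, HasDerivAt w (-ξ * w z) z := fun z => by
    refine ((hasDerivAt_amp μ k σ z).inv (amp_pos μ k hσ z).ne').congr_deriv ?_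
    have := (amp_pos μ k hσ z).ne'
    simp only [hw]
    rw [← hξ]
    field_simp
  set E : ℝ → ℝ := fun z => (σ * Real.exp (σ * z))⁻¹ with hE
  have Epos : ∀ z, σ * Real.exp (σ * z) ≠ 0 := fun z => (mul_pos hσ (Real.exp_pos _)).ne'
  have Es : ContDiff ℝ ((⊤ : ℕ∞) : WithTop ℕ∞) E :=
    (contDiff_const.mul (Real.contDiff_exp.comp (contDiff_const.mul contDiff_id))).inv Epos
  have Ed : ∀ z, HasDerivAt E (-σ * E z) z := fun z => by
    refine (((hasDerivAt_exp_mul σ z).const_mul σ).inv (Epos z)).congr_deriv ?_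
    simp only [hE]
    field_simp
  have q01 := d1.smooth_smul ws wd
  have q12 := (d1.smooth_smul (contDiff_const.mul ws) fun z => (wd z).const_mul (-ξ)).add
    (d2.smooth_smul ws wd)
  set q₁ : ℝ → ℂ := fun z => (-ξ * w z) • G z + w z • G₁ z with hq₁
  have r12 := q12.smooth_smul Es Ed
  set q₂ : ℝ → ℂ := fun z => ((-ξ * (-ξ * w z)) • G z + (-ξ * w z) • G₁ z) +
    ((-ξ * w z) • G₁ z + w z • G₂ z) with hq₂
  set r₂ : ℝ → ℂ := fun z => (-σ * E z) • q₁ z + E z • q₂ z with hr₂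
  have c01 : HasWeakDerivOnHalfLine (fun x => w (Real.log x / σ) • G (Real.log x / σ))
      (fun x => E (Real.log x / σ) • q₁ (Real.log x / σ)) := by
    refine HasWeakDeriv.comp_log (u := fun z => w z • G z) (v := fun z => E z • q₁ z) hσ ?_
    convert q01 using 2 with z
    exact smul_inv_smul₀ (Epos z) _
  have c12 : HasWeakDerivOnHalfLine (fun x => E (Real.log x / σ) • q₁ (Real.log x / σ))
      (fun x => E (Real.log x / σ) • r₂ (Real.log x / σ)) := by
    refine HasWeakDeriv.comp_log (u := fun z => E z • q₁ z) (v := fun z => E z • r₂ z) hσ ?_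
    convert r12 using 2 with z
    exact smul_inv_smul₀ (Epos z) _
  have hfe : ∀ᵐ z : ℝ, f (Real.exp (σ * z)) = w z • G z := by
    filter_upwards [coeFn_lamperti μ k hσ f] with z hz
    rw [hG, hz, pullback, hw, Complex.real_smul, Complex.ofReal_inv, inv_mul_cancel_left₀]
    exact_mod_cast (amp_pos μ k hσ z).ne'
  have hhe : ∀ᵐ z : ℝ, h (Real.exp (σ * z)) = w z • Z z := by
    filter_upwards [coeFn_lamperti μ k hσ h] with z hz
    rw [hZ, hz, pullback, hw, Complex.real_smul, Complex.ofReal_inv, inv_mul_cancel_left₀]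
    exact_mod_cast (amp_pos μ k hσ z).ne'
  refine ⟨_, _, _, c01, c12, ?_, ?_⟩
  · refine (ae_speedMeasure_iff_ae_exp μ k hσ _).2 ?_
    filter_upwards [hfe] with z hz
    rw [log_exp_mul_div hσ, hz]
  · refine (ae_speedMeasure_iff_ae_exp μ k hσ _).2 ?_
    filter_upwards [hhe, hG₂c] with z hz hz2
    rw [log_exp_mul_div hσ, hz]
    have hx := drift_eq μ k hσ
    have hσ' : (σ : ℂ) ≠ 0 := by exact_mod_cast hσ.ne'
    have he' : (Real.exp (σ * z) : ℂ) ≠ 0 := by exact_mod_cast (Real.exp_pos _).ne'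
    simp only [diffExpr, hr₂, hq₁, hq₂, hz2, Complex.real_smul, hE, hx, hc]
    push_cast at he' ⊢
    field_simp
    ring

open FourierTransform in
/-- The Lamperti transform followed by the Fourier transform turns the generator into multiplication
by `-λ_ω` with `ω = 2π η`, the factor `2π` being due to the normalization of the Fourier
transform. -/
lemma generator_isDiagonalizedBy (hσ : 0 < σ) :
    UnboundedOp.IsDiagonalizedBy (generator μ k σ)
      ((lamperti μ k hσ).trans (Lp.fourierTransformₗᵢ ℝ ℂ))
      (fun η => -(lam μ k σ (2 * Real.pi * η) : ℂ)) := by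
  intro f h
  have e : ∀ η : ℝ, -(lam μ k σ (2 * Real.pi * η) : ℂ) =
      (-(2 * Real.pi ^ 2 * η ^ 2 + (xi μ k σ ^ 2 / 2 + k) : ℝ) : ℂ) := fun η => by
    rw [lam]
    push_cast
    ring
  rw [generator_graph μ k hσ]
  simp_rw [e]
  refine ⟨fun hfh => ?_, fun hfh => mem_graph_of_fourier_eq μ k hσ hfh⟩
  exact L2Fourier.fourier_eq_of_weak_equation
    fun φ hφ hc => weak_equation_of_mem_graph μ k hσ hfh hφ hc

lemma continuous_lam : Continuous fun η : ℝ => (lam μ k σ (2 * Real.pi * η) : ℂ) := by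
  unfold lam
  fun_prop

lemma range_lam_two_pi : (range fun η : ℝ => (lam μ k σ (2 * Real.pi * η) : ℂ)) =
    range fun ω : ℝ => (lam μ k σ ω : ℂ) := by
  have : Function.Surjective fun η : ℝ => 2 * Real.pi * η := fun ω =>
    ⟨ω / (2 * Real.pi), mul_div_cancel₀ _ (by positivity)⟩
  exact this.range_comp fun ω : ℝ => (lam μ k σ ω : ℂ)

lemma isClosed_range_lam : IsClosed (range fun ω : ℝ => (lam μ k σ ω : ℂ)) := by
  have h : (range fun ω : ℝ => (lam μ k σ ω : ℂ)) =
      {z : ℂ | z.im = 0} ∩ {z : ℂ | xi μ k σ ^ 2 / 2 + k ≤ z.re} := by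
    ext z
    constructor
    · rintro ⟨ω, rfl⟩
      refine ⟨Complex.ofReal_im _, ?_⟩
      simp only [mem_ofPred_eq, Complex.ofReal_re, lam]
      nlinarith [sq_nonneg ω]
    · rintro ⟨h1, h2⟩
      simp only [mem_ofPred_eq] at h1 h2
      refine ⟨Real.sqrt (2 * (z.re - (xi μ k σ ^ 2 / 2 + k))), ?_⟩
      refine Complex.ext ?_ (by simp [h1])
      simp only [Complex.ofReal_re, lam]
      rw [Real.sq_sqrt (by linarith)]
      ring
  rw [h]
  exact (isClosed_eq Complex.continuous_im continuous_const).inter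
    (isClosed_le continuous_const Complex.continuous_re)

lemma ae_lam_ne (l : ℂ) : ∀ᵐ η : ℝ, (lam μ k σ (2 * Real.pi * η) : ℂ) ≠ l := by
  by_cases h : ∃ η₀ : ℝ, (lam μ k σ (2 * Real.pi * η₀) : ℂ) = l
  · obtain ⟨η₀, rfl⟩ := h
    have hfin : ({η₀, -η₀} : Set ℝ).Finite := by simp
    filter_upwards [hfin.countable.ae_notMem volume] with η hη he
    apply hη
    have h1 : lam μ k σ (2 * Real.pi * η) = lam μ k σ (2 * Real.pi * η₀) := by exact_mod_cast he
    have h2 : (2 * Real.pi) ^ 2 * (η ^ 2 - η₀ ^ 2) = 0 := by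
      rw [lam, lam] at h1
      linarith
    have h3 : η ^ 2 = η₀ ^ 2 := sub_eq_zero.1 ((mul_eq_zero.1 h2).resolve_left (by positivity))
    simpa using sq_eq_sq_iff_eq_or_eq_neg.1 h3
  · push Not at h
    exact ae_of_all _ h

lemma continuousSpectrum_generator (hσ : 0 < σ) :
    UnboundedOp.continuousSpectrum (generator μ k σ) =
      UnboundedOp.spectrum (generator μ k σ) :=
  (generator_isDiagonalizedBy μ k hσ).continuousSpectrum_eq (continuous_lam μ k).neg fun l => by
    filter_upwards [ae_lam_ne μ k (σ := σ) (-l)] with η hη h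
    exact hη (neg_eq_iff_eq_neg.1 h)

lemma spectrum_generator (hσ : 0 < σ) :
    UnboundedOp.spectrum (generator μ k σ) = range fun ω : ℝ => -(lam μ k σ ω : ℂ) := by
  have h : ∀ s : ℝ → ℂ, (range fun ω => -s ω) = -range s := fun s => by
    rw [← image_neg_eq_neg, ← range_comp]
    rfl
  rw [(generator_isDiagonalizedBy μ k hσ).spectrum_eq (continuous_lam μ k).neg, h, h,
    range_lam_two_pi]
  rw [h, range_lam_two_pi]
  exact (isClosed_range_lam μ k).neg

lemma essentialSpectrum_neg_generator (hσ : 0 < σ) :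
    UnboundedOp.essentialSpectrum (-generator μ k σ) = range fun ω : ℝ => (lam μ k σ ω : ℂ) := by
  have h := (generator_isDiagonalizedBy μ k hσ).neg
  have e : (-fun η : ℝ => -(lam μ k σ (2 * Real.pi * η) : ℂ)) =
      fun η : ℝ => (lam μ k σ (2 * Real.pi * η) : ℂ) := by
    funext η
    simp
  rw [e] at h
  rw [h.essentialSpectrum_eq (ae_lam_ne μ k), h.spectrum_eq (continuous_lam μ k),
    range_lam_two_pi]
  rw [range_lam_two_pi]
  exact isClosed_range_lam μ k

/-! ### Improper eigenfunctions -/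

/-- The quantity in the growth condition on improper eigenfunctions is the squared modulus of the
Lamperti transform. -/
lemma norm_sq_mul_speedDensity (hσ : 0 < σ) (f : ℝ → ℂ) {x : ℝ} (hx : 0 < x) :
    ‖f x‖ ^ 2 * (speedDensity μ k σ x * (σ * x)) =
      ‖pullback μ k σ f (Real.log x / σ)‖ ^ 2 := by
  have h := speedDensity_exp_mul μ k hσ (Real.log x / σ)
  rw [exp_mul_log_div hσ hx] at h
  rw [h, pullback, exp_mul_log_div hσ hx, norm_mul, Complex.norm_real, Real.norm_eq_abs,
    mul_pow, sq_abs]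
  ring

/-- The Lamperti transform of `ψ_ω` is the normalized plane wave of frequency `ω`. -/
lemma pullback_psi (hσ : 0 < σ) (ω z : ℝ) : pullback μ k σ (psi μ k σ ω) z =
    ((Real.sqrt (2 * Real.pi))⁻¹ : ℝ) * Complex.exp (Complex.I * ω * z) := by
  have h1 : Real.sqrt (2 / σ) * Real.sqrt (σ / (4 * Real.pi)) = (Real.sqrt (2 * Real.pi))⁻¹ := by
    rw [← Real.sqrt_mul (by positivity), ← Real.sqrt_inv]
    congr 1
    field_simp
    norm_num
  have hσ' : (σ : ℂ) ≠ 0 := by exact_mod_cast hσ.ne'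
  rw [pullback, psi, amp, ← h1, Real.log_exp]
  push_cast
  have h2 : (Complex.I * ω - xi μ k σ) * (1 / σ) * (σ * z) =
      Complex.I * ω * z - (xi μ k σ * z : ℂ) := by
    field_simp
  rw [h2, Complex.exp_sub]
  field_simp [Complex.exp_ne_zero]

lemma norm_pullback_psi (hσ : 0 < σ) (ω z : ℝ) :
    ‖pullback μ k σ (psi μ k σ ω) z‖ = (Real.sqrt (2 * Real.pi))⁻¹ := by
  have : Complex.I * ω * z = ((ω * z : ℝ) : ℂ) * Complex.I := by
    push_cast
    ring
  rw [pullback_psi μ k hσ, norm_mul, this, Complex.norm_exp_ofReal_mul_I, mul_one,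
    Complex.norm_real, Real.norm_of_nonneg (by positivity)]

lemma hasDerivAt_psi (ω : ℝ) {x : ℝ} (hx : 0 < x) :
    HasDerivAt (psi μ k σ ω)
      ((Complex.I * ω - xi μ k σ) * (1 / σ) * (x : ℂ)⁻¹ * psi μ k σ ω x) x := by
  have h1 : HasDerivAt (fun x : ℝ => (Real.log x : ℂ)) ((x⁻¹ : ℝ) : ℂ) x :=
    (Real.hasDerivAt_log hx.ne').ofReal_comp
  have h2 := ((h1.const_mul ((Complex.I * ω - xi μ k σ) * (1 / σ))).cexp).const_mul
    (Real.sqrt (σ / (4 * Real.pi)) : ℂ)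
  refine h2.congr_deriv ?_
  rw [psi]
  push_cast
  ring

lemma hasDerivAt_deriv_psi (ω : ℝ) {x : ℝ} (hx : 0 < x) :
    HasDerivAt (deriv (psi μ k σ ω))
      ((((Complex.I * ω - xi μ k σ) * (1 / σ)) ^ 2 - (Complex.I * ω - xi μ k σ) * (1 / σ)) *
        ((x : ℂ)⁻¹) ^ 2 * psi μ k σ ω x) x := by
  have he : deriv (psi μ k σ ω) =ᶠ[𝓝 x]
      fun x : ℝ => (Complex.I * ω - xi μ k σ) * (1 / σ) * (x : ℂ)⁻¹ * psi μ k σ ω x := by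
    filter_upwards [Ioi_mem_nhds hx] with y hy
    exact (hasDerivAt_psi μ k ω hy).deriv
  have hx' : (x : ℂ) ≠ 0 := by exact_mod_cast hx.ne'
  have h1 : HasDerivAt (fun x : ℝ => (x : ℂ)⁻¹) (-1 / (x : ℂ) ^ 2) x :=
    (hasDerivAt_id x).ofReal_comp.inv hx'
  refine (((h1.const_mul _).mul (hasDerivAt_psi μ k ω hx)).congr_of_eventuallyEq he).congr_deriv ?_
  field_simp
  ring

lemma diffExpr_psi (hσ : 0 < σ) (ω : ℝ) {x : ℝ} (hx : 0 < x) :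
    -diffExpr μ k σ x (psi μ k σ ω x) (deriv (psi μ k σ ω) x) (deriv (deriv (psi μ k σ ω)) x) =
      lam μ k σ ω * psi μ k σ ω x := by
  have hx' : (x : ℂ) ≠ 0 := by exact_mod_cast hx.ne'
  have hσ' : (σ : ℂ) ≠ 0 := by exact_mod_cast hσ.ne'
  have hm := drift_eq μ k hσ
  rw [(hasDerivAt_deriv_psi μ k ω hx).deriv, (hasDerivAt_psi μ k ω hx).deriv, diffExpr, hm, lam]
  push_cast
  field_simp
  linear_combination (-(ω : ℂ) ^ 2 * psi μ k σ ω x) * Complex.I_sq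

lemma contDiffOn_psi (ω : ℝ) : ContDiffOn ℝ 2 (psi μ k σ ω) (Ioi 0) := by
  have h1 : ContDiffOn ℝ 2 (fun x : ℝ => (Real.log x : ℂ)) (Ioi 0) :=
    Complex.ofRealCLM.contDiff.comp_contDiffOn
      (Real.contDiffOn_log.mono fun x hx => ne_of_gt (mem_Ioi.1 hx))
  exact contDiffOn_const.mul ((contDiffOn_const.mul h1).cexp)

lemma isImproperEigenfunction_psi (hσ : 0 < σ) (ω : ℝ) :
    IsImproperEigenfunction μ k σ (lam μ k σ ω) (psi μ k σ ω) := by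
  have hb : ∀ x : ℝ, 0 < x → ‖psi μ k σ ω x‖ ^ 2 * (speedDensity μ k σ x * (σ * x)) ≤
      (Real.sqrt (2 * Real.pi))⁻¹ ^ 2 := fun x hx => by
    rw [norm_sq_mul_speedDensity μ k hσ _ hx, norm_pullback_psi μ k hσ]
  refine ⟨?_, contDiffOn_psi μ k ω, fun x hx => diffExpr_psi μ k hσ ω hx, ?_, ?_, ?_⟩
  · rw [essentialSpectrum_neg_generator μ k hσ]
    exact mem_range_self ω
  · rw [← memLp_pullback_iff μ k hσ]
    intro h
    have h1 := h.norm
    simp_rw [norm_pullback_psi μ k hσ] at h1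
    rw [memLp_const_iff (by norm_num) (by norm_num)] at h1
    rcases h1 with h1 | h1
    · exact (inv_pos.2 (Real.sqrt_pos.2 (by positivity : 0 < 2 * Real.pi))).ne' h1
    · simp at h1
  · exact isBoundedUnder_of_eventually_le (eventually_mem_nhdsWithin.mono fun x hx => hb x hx)
  · exact isBoundedUnder_of_eventually_le ((eventually_gt_atTop 0).mono fun x hx => hb x hx)

lemma eq_const_mul_exp_of_hasDerivAt {p : ℝ → ℂ} {c : ℂ} (h : ∀ z, HasDerivAt p (c * p z) z)
    (z : ℝ) : p z = p 0 * Complex.exp (c * z) := by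
  have h1 : ∀ z : ℝ, HasDerivAt (fun z : ℝ => p z * Complex.exp (-(c * z))) 0 z := fun z => by
    have h2 : HasDerivAt (fun z : ℝ => -(c * (z : ℂ))) (-(c * 1)) z :=
      ((hasDerivAt_id z).ofReal_comp.const_mul c).neg
    refine ((h z).mul h2.cexp).congr_deriv ?_
    ring
  have h3 := is_const_of_deriv_eq_zero (fun z => (h1 z).differentiableAt)
    (fun z => (h1 z).deriv) z 0
  simp only [Complex.ofReal_zero, mul_zero, neg_zero, Complex.exp_zero, mul_one] at h3
  rw [← h3, mul_assoc, ← Complex.exp_add, neg_add_cancel, Complex.exp_zero, mul_one]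

/-- Bounded solutions on the line of `g'' = -ω² g`; boundedness only matters for `ω = 0`, where it
excludes linear growth. -/
lemma exists_eq_exp_add_exp {g g' : ℝ → ℂ} {ω : ℝ} (hg : ∀ z, HasDerivAt g (g' z) z)
    (hg' : ∀ z, HasDerivAt g' (-(ω : ℂ) ^ 2 * g z) z)
    (hb : IsBoundedUnder (· ≤ ·) atTop fun z => ‖g z‖) :
    ∃ c d : ℂ, ∀ z : ℝ, g z =
      c * Complex.exp (Complex.I * ω * z) + d * Complex.exp (Complex.I * (-ω : ℝ) * z) := by
  by_cases hω : ω = 0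
  · subst hω
    have h1 : ∀ z, g' z = g' 0 := fun z => by
      refine is_const_of_deriv_eq_zero (fun z => (hg' z).differentiableAt) (fun z => ?_) z 0
      rw [(hg' z).deriv]
      simp
    have h2 : ∀ z : ℝ, g z = g 0 + g' 0 * z := fun z => by
      have h3 : ∀ z : ℝ, HasDerivAt (fun z : ℝ => g z - g' 0 * z) 0 z := fun z => by
        refine ((hg z).sub ((hasDerivAt_id z).ofReal_comp.const_mul (g' 0))).congr_deriv ?_
        rw [h1 z]
        simp
      have h4 := is_const_of_deriv_eq_zero (fun z => (h3 z).differentiableAt)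
        (fun z => (h3 z).deriv) z 0
      simp only [Complex.ofReal_zero, mul_zero, sub_zero] at h4
      rw [← h4]
      ring
    have h5 : g' 0 = 0 := by
      by_contra h0
      have hpos : 0 < ‖g' 0‖ := norm_pos_iff.2 h0
      have ht : Tendsto (fun z : ℝ => ‖g z‖) atTop atTop := by
        refine tendsto_atTop_mono' (f₁ := fun z : ℝ => ‖g' 0‖ * z + -‖g 0‖) atTop ?_ ?_
        · filter_upwards [eventually_ge_atTop 0] with z hz
          have h6 : ‖g' 0 * (z : ℂ)‖ ≤ ‖g z‖ + ‖g 0‖ := by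
            have : g' 0 * (z : ℂ) = g z - g 0 := by rw [h2 z]; ring
            rw [this]
            exact norm_sub_le _ _
          rw [norm_mul, Complex.norm_real, Real.norm_of_nonneg hz] at h6
          linarith
        · exact tendsto_atTop_add_const_right _ _ (tendsto_id.const_mul_atTop hpos)
      exact not_isBoundedUnder_of_tendsto_atTop ht hb
    refine ⟨g 0, 0, fun z => ?_⟩
    rw [h2 z, h5]
    simp
  · have hωc : (ω : ℂ) ≠ 0 := by exact_mod_cast hω
    have hI := Complex.I_ne_zero
    -- the equation factors as `(∂ - iω)(∂ + iω) g = 0`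
    have hp := eq_const_mul_exp_of_hasDerivAt (p := fun z => g' z + Complex.I * ω * g z)
      (c := Complex.I * ω) fun z => by
        refine ((hg' z).add ((hg z).const_mul (Complex.I * ω))).congr_deriv ?_
        linear_combination (-(ω : ℂ) ^ 2 * g z) * Complex.I_sq
    have hq := eq_const_mul_exp_of_hasDerivAt (p := fun z => g' z - Complex.I * ω * g z)
      (c := Complex.I * (-ω : ℝ)) fun z => by
        refine ((hg' z).sub ((hg z).const_mul (Complex.I * ω))).congr_deriv ?_
        push_cast
        linear_combination (-(ω : ℂ) ^ 2 * g z) * Complex.I_sq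
    refine ⟨(g' 0 + Complex.I * ω * g 0) / (2 * Complex.I * ω),
      -(g' 0 - Complex.I * ω * g 0) / (2 * Complex.I * ω), fun z => ?_⟩
    have h1 := hp z
    have h2 := hq z
    rw [div_mul_eq_mul_div, div_mul_eq_mul_div, ← add_div, eq_div_iff (by simp [hω]),
      neg_mul, ← h1, ← h2]
    ring

lemma hasDerivAt_pullback {f : ℝ → ℂ} (hf : ∀ x : ℝ, 0 < x → DifferentiableAt ℝ f x)
    (z : ℝ) : HasDerivAt (pullback μ k σ f)
      (xi μ k σ * pullback μ k σ f z + σ * (Real.exp (σ * z) * pullback μ k σ (deriv f) z)) z := by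
  have h1 : HasDerivAt (fun z => f (Real.exp (σ * z)))
      ((σ * Real.exp (σ * z)) • deriv f (Real.exp (σ * z))) z :=
    HasDerivAt.scomp (h := fun z => Real.exp (σ * z)) z (hf _ (Real.exp_pos _)).hasDerivAt
      (hasDerivAt_exp_mul σ z)
  refine ((hasDerivAt_amp μ k σ z).ofReal_comp.mul h1).congr_deriv ?_
  simp only [pullback, Complex.real_smul]
  push_cast
  ring

lemma IsImproperEigenfunction.exists_eq (hσ : 0 < σ) {l : ℂ} {f : ℝ → ℂ}
    (h : IsImproperEigenfunction μ k σ l f) :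
    ∃ (ω : ℝ) (c d : ℂ), l = lam μ k σ ω ∧
      ∀ x : ℝ, 0 < x → f x = c * psi μ k σ ω x + d * psi μ k σ (-ω) x := by
  obtain ⟨hl, hf, heq, -, -, hb⟩ := h
  rw [essentialSpectrum_neg_generator μ k hσ] at hl
  obtain ⟨ω, rfl⟩ := hl
  have hf1 : ∀ x : ℝ, 0 < x → DifferentiableAt ℝ f x := fun x hx =>
    (hf.contDiffAt (Ioi_mem_nhds hx)).differentiableAt (by norm_num)
  have hf2 : ∀ x : ℝ, 0 < x → DifferentiableAt ℝ (deriv f) x := fun x hx =>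
    ((hf.deriv_of_isOpen (m := 1) isOpen_Ioi (by norm_num)).contDiffAt
      (Ioi_mem_nhds hx)).differentiableAt (by norm_num)
  have hm := drift_eq μ k hσ
  have hd1 := hasDerivAt_pullback μ k (σ := σ) hf1
  have hd2 : ∀ z, HasDerivAt (fun z => (xi μ k σ : ℂ) * pullback μ k σ f z +
      σ * (Real.exp (σ * z) * pullback μ k σ (deriv f) z))
      (-(ω : ℂ) ^ 2 * pullback μ k σ f z) z := fun z => by
    refine (((hd1 z).const_mul _).add (((hasDerivAt_exp_mul σ z).ofReal_comp.mul
      (hasDerivAt_pullback μ k hf2 z)).const_mul _)).congr_deriv ?_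
    have := heq _ (Real.exp_pos (σ * z))
    simp only [diffExpr, hm, lam] at this
    simp only [pullback]
    push_cast at this ⊢
    linear_combination (-2 * (amp μ k σ z : ℂ)) * this
  have hbz : IsBoundedUnder (· ≤ ·) atTop fun z => ‖pullback μ k σ f z‖ := by
    obtain ⟨B, hB⟩ := hb.eventually_le
    refine isBoundedUnder_of_eventually_le (a := Real.sqrt B) ?_
    have ht : Tendsto (fun z => Real.exp (σ * z)) atTop atTop :=
      Real.tendsto_exp_atTop.comp (tendsto_id.const_mul_atTop hσ)
    filter_upwards [ht.eventually hB] with z hz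
    rw [norm_sq_mul_speedDensity μ k hσ f (Real.exp_pos _), log_exp_mul_div hσ] at hz
    exact Real.le_sqrt_of_sq_le hz
  obtain ⟨c, d, hcd⟩ := exists_eq_exp_add_exp hd1 hd2 hbz
  have hr : 0 < Real.sqrt (2 * Real.pi) := Real.sqrt_pos.2 (by positivity)
  refine ⟨ω, Real.sqrt (2 * Real.pi) * c, Real.sqrt (2 * Real.pi) * d, rfl, fun x hx => ?_⟩
  have ha : (amp μ k σ (Real.log x / σ) : ℂ) ≠ 0 := by exact_mod_cast (amp_pos μ k hσ _).ne'
  have hrc : (Real.sqrt (2 * Real.pi) : ℂ) ≠ 0 := by exact_mod_cast hr.ne'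
  have e0 := hcd (Real.log x / σ)
  have e1 := pullback_psi μ k hσ ω (Real.log x / σ)
  have e2 := pullback_psi μ k hσ (-ω) (Real.log x / σ)
  rw [pullback, exp_mul_log_div hσ hx] at e0 e1 e2
  refine mul_left_cancel₀ ha ?_
  rw [e0, mul_add, mul_left_comm, e1, mul_left_comm (amp μ k σ _ : ℂ), e2, Complex.ofReal_inv]
  field_simp

/-! ### Delta normalization -/

lemma setIntegral_Ioo_eq_setIntegral_exp (hσ : 0 < σ) {a b : ℝ} (ha : 0 < a) (hab : a < b)
    (F : ℝ → ℂ) : ∫ x in Ioo a b, F x =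
      ∫ z in Ioo (Real.log a / σ) (Real.log b / σ),
        (σ * Real.exp (σ * z)) • F (Real.exp (σ * z)) := by
  have h1 : Ioi (0 : ℝ) ∩ Ioo a b = Ioo a b :=
    inter_eq_right.2 fun x hx => ha.trans hx.1
  have h2 : ∀ z, Real.exp (σ * z) ∈ Ioo a b ↔ z ∈ Ioo (Real.log a / σ) (Real.log b / σ) := by
    intro z
    rw [mem_Ioo, mem_Ioo, div_lt_iff₀' hσ, lt_div_iff₀' hσ, Real.log_lt_iff_lt_exp ha,
      Real.lt_log_iff_exp_lt (ha.trans hab)]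
  rw [← h1, ← setIntegral_indicator measurableSet_Ioo, integral_Ioi_eq_integral_exp hσ,
    ← integral_indicator measurableSet_Ioo]
  refine integral_congr_ae (ae_of_all _ fun z => ?_)
  by_cases hz : z ∈ Ioo (Real.log a / σ) (Real.log b / σ)
  · simp only [indicator_of_mem hz, indicator_of_mem ((h2 z).2 hz)]
  · simp only [indicator_of_notMem hz, indicator_of_notMem (fun h => hz ((h2 z).1 h)), smul_zero]

lemma truncatedInner_psi (hσ : 0 < σ) {a b : ℝ} (ha : 0 < a) (hab : a < b) (ω ν : ℝ) :
    truncatedInner (speedDensity μ k σ) a b (psi μ k σ ω) (psi μ k σ ν) =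
      ∫ z in Ioo (Real.log a / σ) (Real.log b / σ),
        (2 * Real.pi : ℂ)⁻¹ * Complex.exp (Complex.I * (ν - ω) * z) := by
  rw [truncatedInner, setIntegral_Ioo_eq_setIntegral_exp hσ ha hab]
  refine integral_congr_ae (ae_of_all _ fun z => ?_)
  have h1 : (σ * Real.exp (σ * z)) • (conj (psi μ k σ ω (Real.exp (σ * z))) *
      psi μ k σ ν (Real.exp (σ * z)) * (speedDensity μ k σ (Real.exp (σ * z)) : ℂ)) =
      conj (pullback μ k σ (psi μ k σ ω) z) * pullback μ k σ (psi μ k σ ν) z := by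
    have h2 := congrArg Complex.ofReal (speedDensity_exp_mul μ k hσ z)
    simp only [pullback, map_mul, Complex.conj_ofReal, Complex.real_smul]
    push_cast at h2 ⊢
    linear_combination (conj (psi μ k σ ω (Real.exp (σ * z))) * psi μ k σ ν (Real.exp (σ * z))) * h2
  have hs : ((Real.sqrt (2 * Real.pi))⁻¹ : ℝ) * ((Real.sqrt (2 * Real.pi))⁻¹ : ℝ) =
      (2 * Real.pi)⁻¹ := by
    rw [← mul_inv, Real.mul_self_sqrt (by positivity)]
  simp only
  rw [h1, pullback_psi μ k hσ, pullback_psi μ k hσ, map_mul, Complex.conj_ofReal,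
    ← Complex.exp_conj, mul_mul_mul_comm, ← Complex.ofReal_mul, hs, ← Complex.exp_add]
  simp only [map_mul, Complex.conj_I, Complex.conj_ofReal]
  push_cast
  congr 2
  ring

lemma continuousOn_speedDensity (hσ : 0 < σ) : ContinuousOn (speedDensity μ k σ) (Ioi 0) := by
  have h0 : ContinuousOn Real.log (Ioi 0) :=
    Real.continuousOn_log.mono fun x hx => ne_of_gt (mem_Ioi.1 hx)
  refine ContinuousOn.mul ?_ ?_
  · exact continuousOn_const.div (continuousOn_id.mul continuousOn_const) fun x hx =>
      mul_ne_zero (ne_of_gt (mem_Ioi.1 hx)) (pow_ne_zero _ hσ.ne')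
  · exact Real.continuous_exp.comp_continuousOn (continuousOn_const.mul h0)

lemma integrable_schwartz_mul_exp (φ : 𝓢(ℝ, ℂ)) (ω A B : ℝ) :
    Integrable (fun p : ℝ × ℝ => φ p.1 *
      ((2 * Real.pi : ℂ)⁻¹ * Complex.exp (Complex.I * (p.1 - ω) * p.2)))
      (volume.prod (volume.restrict (Ioo A B))) := by
  have h1 : Integrable (fun p : ℝ × ℝ => φ p.1 * (2 * Real.pi : ℂ)⁻¹)
      (volume.prod (volume.restrict (Ioo A B))) :=
    φ.integrable.mul_prod (integrable_const _)
  refine h1.mono ?_ (ae_of_all _ fun p => ?_)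
  · have := φ.continuous
    exact Continuous.aestronglyMeasurable (by fun_prop)
  · have : Complex.I * (p.1 - ω) * p.2 = (((p.1 - ω) * p.2 : ℝ) : ℂ) * Complex.I := by
      push_cast
      ring
    rw [this, norm_mul, norm_mul, norm_mul, Complex.norm_exp_ofReal_mul_I, mul_one]

open FourierTransform in
/-- By Fubini, the truncated pairings are truncations of the inverse Fourier integral. -/
lemma integral_mul_truncated (φ : 𝓢(ℝ, ℂ)) (ω A B : ℝ) :
    ∫ ν, φ ν * ∫ z in Ioo A B,
        (2 * Real.pi : ℂ)⁻¹ * Complex.exp (Complex.I * (ν - ω) * z) =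
      ∫ z in Ioo A B, (2 * Real.pi : ℂ)⁻¹ *
        (Complex.exp (-(Complex.I * ω * z)) * (𝓕⁻ φ : 𝓢(ℝ, ℂ)) ((2 * Real.pi)⁻¹ * z)) := by
  simp_rw [← integral_const_mul (φ _)]
  rw [integral_integral_swap (integrable_schwartz_mul_exp φ ω A B)]
  refine integral_congr_ae (ae_of_all _ fun z => ?_)
  simp only
  rw [SchwartzMap.fourierInv_coe, Real.fourierInv_eq', ← integral_const_mul, ← integral_const_mul]
  refine integral_congr_ae (ae_of_all _ fun ν => ?_)
  have h1 : (2 * Real.pi * inner ℝ ν ((2 * Real.pi)⁻¹ * z) : ℝ) = ν * z := by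
    simp only [RCLike.inner_apply, conj_trivial]
    field_simp
  simp only [smul_eq_mul]
  rw [h1, ← mul_assoc (Complex.exp _) (Complex.exp _), ← Complex.exp_add]
  have h2 : -(Complex.I * ω * z) + ((ν * z : ℝ) : ℂ) * Complex.I = Complex.I * (ν - ω) * z := by
    push_cast
    ring
  rw [h2]
  ring

open FourierTransform in
lemma integrable_exp_mul_fourierInv (φ : 𝓢(ℝ, ℂ)) (ω : ℝ) :
    Integrable fun z : ℝ => (2 * Real.pi : ℂ)⁻¹ *
      (Complex.exp (-(Complex.I * ω * z)) * (𝓕⁻ φ : 𝓢(ℝ, ℂ)) ((2 * Real.pi)⁻¹ * z)) := by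
  have h1 : Integrable fun z : ℝ => (𝓕⁻ φ : 𝓢(ℝ, ℂ)) ((2 * Real.pi)⁻¹ * z) :=
    (𝓕⁻ φ : 𝓢(ℝ, ℂ)).integrable.comp_mul_left' (by positivity)
  refine Integrable.const_mul (h1.mono ?_ (ae_of_all _ fun z => ?_)) _
  · have := (𝓕⁻ φ : 𝓢(ℝ, ℂ)).continuous
    exact Continuous.aestronglyMeasurable (by fun_prop)
  · have : -(Complex.I * ω * z) = ((-(ω * z) : ℝ) : ℂ) * Complex.I := by
      push_cast
      ring
    rw [this, norm_mul, Complex.norm_exp_ofReal_mul_I, one_mul]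

open FourierTransform in
lemma integral_exp_mul_fourierInv (φ : 𝓢(ℝ, ℂ)) (ω : ℝ) :
    ∫ z : ℝ, (2 * Real.pi : ℂ)⁻¹ *
      (Complex.exp (-(Complex.I * ω * z)) * (𝓕⁻ φ : 𝓢(ℝ, ℂ)) ((2 * Real.pi)⁻¹ * z)) = φ ω := by
  have h1 : φ ω = 𝓕 (𝓕⁻ φ : 𝓢(ℝ, ℂ)) ω := by rw [fourier_fourierInv_eq]
  rw [h1, SchwartzMap.fourier_coe, Real.fourier_eq', integral_const_mul]
  have h2 := Measure.integral_comp_mul_left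
    (fun y : ℝ => Complex.exp (-(2 * Real.pi * Complex.I * ω * y)) * (𝓕⁻ φ : 𝓢(ℝ, ℂ)) y)
    (2 * Real.pi)⁻¹
  have h3 : ∀ z : ℝ, (2 * Real.pi * Complex.I * ω * (((2 * Real.pi)⁻¹ * z : ℝ) : ℂ)) =
      Complex.I * ω * z := fun z => by
    have : (Real.pi : ℂ) ≠ 0 := by exact_mod_cast Real.pi_ne_zero
    push_cast
    field_simp
  simp_rw [h3] at h2
  rw [h2, inv_inv, abs_of_pos (by positivity), Complex.real_smul]
  have : (2 * Real.pi : ℂ) ≠ 0 := by exact_mod_cast (by positivity : (2 * Real.pi : ℝ) ≠ 0)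
  push_cast
  rw [inv_mul_cancel_left₀ this]
  refine integral_congr_ae (ae_of_all _ fun y => ?_)
  simp only [RCLike.inner_apply, conj_trivial, smul_eq_mul]
  congr 2
  push_cast
  ring

lemma isDeltaNormalized_psi (hσ : 0 < σ) :
    IsDeltaNormalized (speedDensity μ k σ) (psi μ k σ) := by
  refine ⟨fun ω ν a b ha hab => ?_, fun φ ω => ⟨fun a b ha hab => ?_, ?_⟩⟩
  · have hsub : Icc a b ⊆ Ioi 0 := fun x hx => ha.trans_le hx.1
    have hc : ContinuousOn (fun x => conj (psi μ k σ ω x) * psi μ k σ ν x *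
        (speedDensity μ k σ x : ℂ)) (Icc a b) :=
      ((Complex.continuous_conj.comp_continuousOn
        ((contDiffOn_psi μ k ω).continuousOn.mono hsub)).mul
        ((contDiffOn_psi μ k ν).continuousOn.mono hsub)).mul
        (Complex.continuous_ofReal.comp_continuousOn ((continuousOn_speedDensity μ k hσ).mono hsub))
    exact hc.integrableOn_Icc.mono_set Ioo_subset_Icc_self
  · simp_rw [truncatedInner_psi μ k hσ ha hab]
    refine (integrable_schwartz_mul_exp φ ω (Real.log a / σ)
      (Real.log b / σ)).integral_prod_left.congr (ae_of_all _ fun ν => ?_)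
    exact integral_const_mul (φ ν) _
  · have hA : Tendsto (fun p : ℝ × ℝ => Real.log p.1 / σ) (𝓝[>] 0 ×ˢ atTop) atBot :=
      (Real.tendsto_log_nhdsGT_zero.comp tendsto_fst).atBot_div_const hσ
    have hB : Tendsto (fun p : ℝ × ℝ => Real.log p.2 / σ) (𝓝[>] 0 ×ˢ atTop) atTop :=
      (Real.tendsto_log_atTop.comp tendsto_snd).atTop_div_const hσ
    have hlim := (aecover_Ioo (μ := volume) hA hB).integral_tendsto_of_countably_generated
      (integrable_exp_mul_fourierInv φ ω)
    rw [integral_exp_mul_fourierInv] at hlim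
    refine hlim.congr' ?_
    have h1 : ∀ᶠ a : ℝ in 𝓝[>] 0, a ∈ Ioo (0 : ℝ) 1 := Ioo_mem_nhdsGT one_pos
    have h2 : ∀ᶠ b : ℝ in atTop, 1 < b := eventually_gt_atTop 1
    filter_upwards [h1.prod_mk h2] with p hp
    simp_rw [truncatedInner_psi μ k hσ hp.1.1 (hp.1.2.trans hp.2)]
    exact (integral_mul_truncated φ ω _ _).symm

end GBM

theorem mainTheorem9 (μ k σ : ℝ) (hk : 0 ≤ k) (hσ : 0 < σ) :
    -- the spectrum is purely continuous, and equal to the set of the `-λ_ω`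
    UnboundedOp.spectrum (GBM.generator μ k σ) =
      UnboundedOp.continuousSpectrum (GBM.generator μ k σ) ∧
    UnboundedOp.spectrum (GBM.generator μ k σ) =
      range (fun ω : ℝ => -(GBM.lam μ k σ ω : ℂ)) ∧
    -- `ψ_ω` is an improper eigenfunction with improper eigenvalue `λ_ω`
    (∀ ω : ℝ, GBM.IsImproperEigenfunction μ k σ (GBM.lam μ k σ ω) (GBM.psi μ k σ ω)) ∧
    -- there are no others, up to linear combinations for the same eigenvalue
    (∀ (l : ℂ) (f : ℝ → ℂ), GBM.IsImproperEigenfunction μ k σ l f →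
      ∃ (ω : ℝ) (c d : ℂ), l = GBM.lam μ k σ ω ∧
        ∀ x : ℝ, 0 < x → f x = c * GBM.psi μ k σ ω x + d * GBM.psi μ k σ (-ω) x) ∧
    -- delta normalization
    IsDeltaNormalized (GBM.speedDensity μ k σ) (GBM.psi μ k σ) :=
  ⟨(GBM.continuousSpectrum_generator μ k hσ).symm, GBM.spectrum_generator μ k hσ,
    GBM.isImproperEigenfunction_psi μ k hσ, fun _ _ h => h.exists_eq μ k hσ,
    GBM.isDeltaNormalized_psi μ k hσ⟩
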